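/- A Dyck path of semilength $n$ is a lattice path from $(0,0)$ to $(2n,0)$ with steps $U=(1,1)$ and $D=(1,-1)$ that never goes below the $x$-axis. A peak (valley) is the common point of a $U$ immediately followed by a $D$ (of a $D$ immediately followed by a $U$); $\mathrm{pk}(d)$ is the number of peaks of $d$. The bounce path $\mathrm{bounce}(d)$ starts at $(0,0)$, moves by up-steps until it encounters a down-step of $d$ (that is, reaches a point of $d$ from which $d$ continues with a down-step), then moves by down-steps to the $x$-axis, and repeats this until $(2n,0)$ is reached; $\mathrm{bcomp}(d)$ is the sequence of heights of the peaks of $\mathrm{bounce}(d)$, a composition of $n$. Let $B_d$ be the set of Dyck paths $b$ of semilength $n$ such that $b$ lies weakly below $d$, $\mathrm{pk}(b)=\mathrm{pk}(\mathrm{bounce}(d))$, each peak of $b$ is a point of $d$, and each valley of $b$ is a valley of $d$ or has height $0$. **Proposition.** (1) For every Dyck path $d$, $|B_d|=1$ if and only if each peak of $\mathrm{bounce}(d)$ is also a peak of $d$. (2) For every $n\ge 0$ and every composition $c=(c_1,\dots,c_k)$ of $n$, the number of Dyck paths $d$ of semilength $n$ such that $\mathrm{bcomp}(d)=c$ and each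 peak of $\mathrm{bounce}(d)$ is also a peak of $d$ is $$\prod_{i=1}^{k-1}\binom{c_i+c_{i+1}-2}{c_{i+1}-1}.$$ (3) Consequently, for every $n\ge 0$, the number of Dyck paths $d$ of semilength $n$ with $|B_d|=1$ is $$\sum_{c=(c_1,\dots,c_k)}\ \prod_{i=1}^{k-1}\binom{c_i+c_{i+1}-2}{c_{i+1}-1},$$ where the sum is over all compositions $c$ of $n$. (4) For every $n\ge 0$, this number is also the number of Dyck paths of semilength $n$ whose maximum height is attained by their first peak (OEIS A287709; for $n=0$ the empty path is counted). -/

import Mathlib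

/-! Dyck paths are Mathlib's `DyckWord`s: lists of steps `U = (1, 1)` and `D = (1, -1)`. -/

namespace DyckBounce

open DyckStep

/-- The height (ordinate) of the path at abscissa `x`. -/
def height (d : DyckWord) (x : ℕ) : ℤ :=
  ((d.toList.take x).count U : ℤ) - ((d.toList.take x).count D : ℤ)

/-- The peaks of a path, each given by its point: the common end of an up-step and of the
down-step that immediately follows it. -/
def peaks (d : DyckWord) : Finset (ℕ × ℤ) :=
  ((Finset.range d.toList.length).filter
    (fun i => d.toList[i]? = some U ∧ d.toList[i + 1]? = some D)).image
      (fun i => (i + 1, height d (i + 1)))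

/-- The valleys of a path, each given by its point: the common end of a down-step and of the
up-step that immediately follows it. -/
def valleys (d : DyckWord) : Finset (ℕ × ℤ) :=
  ((Finset.range d.toList.length).filter
    (fun i => d.toList[i]? = some D ∧ d.toList[i + 1]? = some U)).image
      (fun i => (i + 1, height d (i + 1)))

/-- The number of peaks. -/
def pk (d : DyckWord) : ℕ := (peaks d).card

/-- Moving up from the point `(2 * s, 0)`, the number of up-steps made until a down-step of `d`
is encountered: the least `c` such that `(2 * s + c, c)` is a point of `d` from which `d`
continues with a down-step. (Such a `c` exists, and is positive, as long as `s` is smaller than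
the semilength of `d`.) -/
noncomputable def ascent (d : DyckWord) (s : ℕ) : ℕ :=
  sInf {c : ℕ | height d (2 * s + c) = c ∧ d.toList[2 * s + c]? = some D}

/-- The lengths of the successive ascents of the bounce path of `d` from the point `(2 * s, 0)`
on: after an ascent of length `c` the bounce path descends to the `x`-axis, which it meets at
`(2 * (s + c), 0)`, and it stops when it reaches the end of `d`. The first argument bounds the
number of ascents. -/
noncomputable def bounceAscents (d : DyckWord) : ℕ → ℕ → List ℕ
  | 0, _ => []
  | k + 1, s =>
    if s < d.semilength then ascent d s :: bounceAscents d k (s + ascent d s) else []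

/-- The sequence of the heights of the peaks of the bounce path. Since every ascent is positive,
there are at most `d.semilength` of them. -/
noncomputable def bcomp (d : DyckWord) : List ℕ := bounceAscents d d.semilength 0

/-- The path `U ^ c D ^ c`. -/
def pyramid (c : ℕ) : DyckWord := DyckWord.nest^[c] 0

/-- The bounce path of `d`: `U ^ c₁ D ^ c₁ ⋯ U ^ cₖ D ^ cₖ` with `(c₁, …, cₖ) = bcomp d`. -/
noncomputable def bounce (d : DyckWord) : DyckWord := ((bcomp d).map pyramid).sum

/-- `b` is under `d`. -/
def Under (b d : DyckWord) : Prop := ∀ x, height b x ≤ height d x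

/-- The set `B_d`. -/
def B (d : DyckWord) : Set DyckWord :=
  {b | b.semilength = d.semilength ∧
    Under b d ∧
    pk b = pk (bounce d) ∧
    (∀ P ∈ peaks b, height d P.1 = P.2) ∧
    (∀ P ∈ valleys b, P ∈ valleys d ∨ P.2 = 0)}

/-- The maximum height of the path is attained by its first peak (no condition on the empty
path, which has no peak). -/
def MaxAtFirstPeak (d : DyckWord) : Prop :=
  ∀ P ∈ peaks d, (∀ Q ∈ peaks d, P.1 ≤ Q.1) → ∀ x, height d x ≤ P.2

/-- The product of `(cᵢ + cᵢ₊₁ - 2).choose (cᵢ₊₁ - 1)` over `1 ≤ i ≤ k - 1`, for a composition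
`(c₁, …, cₖ)`; all `cᵢ` are positive. -/
def weight {n : ℕ} (c : Composition n) : ℕ :=
  (List.zipWith (fun a b => (a + b - 2).choose (b - 1)) c.blocks c.blocks.tail).prod

end DyckBounce

/-! Record a point of a path by its numbers (a, v) of up-steps and down-steps. The bounce path is
greedy: from the axis point (s, s), its next peak is the last point of `d` with s down-steps. Hence
a path with its peaks on `d` never gets ahead of the bounce path, peak by peak, and with no more
peaks it must keep pace with it to reach the end. If every bounce peak also ends an up-step of `d`,
it is the first point of `d` with its number of up-steps; working back from the end, this squeezes
every element of `B d` onto the bounce path (`IsBounce.eq_pyramids`). Otherwise consider the first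
bounce peak that follows a down-step of `d`. It is not the initial peak; raising it by one and
lowering its predecessor by one gives a second element of `B d` (`IsBounce.exists_peaksOn_ne`).

For the count by composition, if consecutive bounce peaks of heights a and b are peaks of `d`, then
between them `d` reads D w U, where w is any word with a - 1 down-steps and b - 1 up-steps. These
choices are independent, whence the product of binomials (`ncard_peaks_bounce_subset`).

Paths with maximum at the first peak are sorted instead by their numbers of up-steps per level.
Removing the lowest level of a path with a components leaves a path e with b components. If e is
nonempty, the condition says that the first of the a inner words is nonempty and that e satisfies it
too. Recovering the path from e amounts to distributing the other b - 1 components among a ordered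
words, which gives the same binomial (`ncard_maxAtFirstPeak_levels`). So the two families are
equinumerous for each composition. -/

namespace DyckBounce

open DyckStep

/-! ### Step counts and points of a path -/

/-- The number of up-steps among the first `x` steps. -/
def ups (l : List DyckStep) (x : ℕ) : ℕ := (l.take x).count U

/-- The number of down-steps among the first `x` steps. -/
def downs (l : List DyckStep) (x : ℕ) : ℕ := (l.take x).count D

lemma count_U_add_count_D (l : List DyckStep) : l.count U + l.count D = l.length := by
  induction l with
  | nil => rfl
  | cons s l ih => cases s <;> simp <;> omega

lemma ups_add_downs {l : List DyckStep} {x : ℕ} (h : x ≤ l.length) :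
    ups l x + downs l x = x := by
  rw [ups, downs, count_U_add_count_D, List.length_take, min_eq_left h]

lemma ups_mono (l : List DyckStep) : Monotone (ups l) := fun _ _ h =>
  (List.take_sublist_take_left h).count_le U

lemma downs_mono (l : List DyckStep) : Monotone (downs l) := fun _ _ h =>
  (List.take_sublist_take_left h).count_le D

lemma ups_zero (l : List DyckStep) : ups l 0 = 0 := by simp [ups]

lemma downs_zero (l : List DyckStep) : downs l 0 = 0 := by simp [downs]

lemma ups_succ_of_U {l : List DyckStep} {x : ℕ} (h : l[x]? = some U) :
    ups l (x + 1) = ups l x + 1 := by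
  simp [ups, List.take_add_one, h]

lemma ups_succ_of_D {l : List DyckStep} {x : ℕ} (h : l[x]? = some D) :
    ups l (x + 1) = ups l x := by
  simp [ups, List.take_add_one, h]

lemma downs_succ_of_U {l : List DyckStep} {x : ℕ} (h : l[x]? = some U) :
    downs l (x + 1) = downs l x := by
  simp [downs, List.take_add_one, h]

lemma downs_succ_of_D {l : List DyckStep} {x : ℕ} (h : l[x]? = some D) :
    downs l (x + 1) = downs l x + 1 := by
  simp [downs, List.take_add_one, h]

lemma ups_of_length_le {l : List DyckStep} {x : ℕ} (h : l.length ≤ x) :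
    ups l x = l.count U := by rw [ups, List.take_of_length_le h]

lemma downs_of_length_le {l : List DyckStep} {x : ℕ} (h : l.length ≤ x) :
    downs l x = l.count D := by rw [downs, List.take_of_length_le h]

lemma ups_append (l m : List DyckStep) (x : ℕ) :
    ups (l ++ m) (l.length + x) = l.count U + ups m x := by
  simp [ups, List.take_append, List.take_of_length_le]

lemma downs_append (l m : List DyckStep) (x : ℕ) :
    downs (l ++ m) (l.length + x) = l.count D + downs m x := by
  simp [downs, List.take_append, List.take_of_length_le]

lemma ups_append_of_le {l : List DyckStep} (m : List DyckStep) {x : ℕ} (h : x ≤ l.length) :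
    ups (l ++ m) x = ups l x := by
  rw [ups, List.take_append_of_le_length h, ups]

lemma downs_append_of_le {l : List DyckStep} (m : List DyckStep) {x : ℕ} (h : x ≤ l.length) :
    downs (l ++ m) x = downs l x := by
  rw [downs, List.take_append_of_le_length h, downs]

lemma getElem?_eq_U_or_D {l : List DyckStep} {x : ℕ} (h : x < l.length) :
    l[x]? = some U ∨ l[x]? = some D := by
  rw [List.getElem?_eq_getElem h]
  rcases DyckStep.dichotomy l[x] with h | h <;> simp [h]

lemma lt_length_of_getElem? {l : List DyckStep} {x : ℕ} {s : DyckStep} (h : l[x]? = some s) :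
    x < l.length := by
  by_contra hx
  rw [List.getElem?_eq_none (not_lt.mp hx)] at h
  simp at h

lemma height_eq (d : DyckWord) (x : ℕ) :
    height d x = (ups d.toList x : ℤ) - downs d.toList x := rfl

lemma downs_le_ups (d : DyckWord) (x : ℕ) : downs d.toList x ≤ ups d.toList x :=
  d.count_D_le_count_U x

lemma length_toList (d : DyckWord) : d.toList.length = 2 * d.semilength :=
  DyckWord.two_mul_semilength_eq_length.symm

lemma ups_le_semilength (d : DyckWord) (x : ℕ) : ups d.toList x ≤ d.semilength :=
  (List.take_sublist _ _).count_le U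

lemma height_of_length_le {d : DyckWord} {x : ℕ} (h : d.toList.length ≤ x) : height d x = 0 := by
  rw [height_eq, ups_of_length_le h, downs_of_length_le h, d.count_U_eq_count_D, sub_self]

lemma height_nonneg (d : DyckWord) (x : ℕ) : 0 ≤ height d x := by
  have := downs_le_ups d x
  rw [height_eq]; omega

lemma abs_height_succ_sub (d : DyckWord) (x : ℕ) : |height d (x + 1) - height d x| ≤ 1 := by
  rcases lt_or_ge x d.toList.length with h | h
  · rcases getElem?_eq_U_or_D h with h | h
    · rw [height_eq, height_eq, ups_succ_of_U h, downs_succ_of_U h, abs_le]; omega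
    · rw [height_eq, height_eq, ups_succ_of_D h, downs_succ_of_D h, abs_le]; omega
  · rw [height_of_length_le h, height_of_length_le (by omega)]; simp

lemma abs_height_add_sub (d : DyckWord) (x k : ℕ) : |height d (x + k) - height d x| ≤ k := by
  induction k with
  | zero => simp
  | succ k ih =>
    have := abs_height_succ_sub d (x + k)
    rw [abs_le] at *
    rw [← add_assoc]
    push_cast
    omega

/-- The path passes through the point reached after `a` up-steps and `v` down-steps. -/
def OnPath (d : DyckWord) (a v : ℕ) : Prop :=
  ups d.toList (a + v) = a ∧ downs d.toList (a + v) = v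

lemma onPath_of_height {d : DyckWord} {a v : ℕ} (hx : a + v ≤ d.toList.length)
    (h : height d (a + v) = a - v) : OnPath d a v := by
  have := ups_add_downs hx
  rw [height_eq] at h
  constructor <;> omega

lemma OnPath.height_eq {d : DyckWord} {a v : ℕ} (h : OnPath d a v) :
    height d (a + v) = a - v := by
  rw [DyckBounce.height_eq, h.1, h.2]

lemma onPath_ups_downs {d : DyckWord} {x : ℕ} (h : x ≤ d.toList.length) :
    OnPath d (ups d.toList x) (downs d.toList x) := by
  rw [OnPath, ups_add_downs h]
  exact ⟨rfl, rfl⟩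

/-- A point from which the path goes down is the last one with its number of down-steps. -/
lemma ups_le_of_downs_le {d : DyckWord} {x y : ℕ} (h : d.toList[x]? = some D)
    (hy : downs d.toList y ≤ downs d.toList x) : ups d.toList y ≤ ups d.toList x ∧ y ≤ x := by
  rcases le_or_gt y x with hyx | hyx
  · exact ⟨ups_mono _ hyx, hyx⟩
  · have := downs_mono d.toList (show x + 1 ≤ y by omega)
    rw [downs_succ_of_D h] at this
    omega

/-- A point reached by an up-step is the first one with its number of up-steps. -/
lemma downs_le_of_ups_le {d : DyckWord} {x y : ℕ} (h : d.toList[x]? = some U)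
    (hy : ups d.toList (x + 1) ≤ ups d.toList y) :
    downs d.toList (x + 1) ≤ downs d.toList y := by
  rcases le_or_gt (x + 1) y with hyx | hyx
  · exact downs_mono _ hyx
  · have := ups_mono d.toList (show y ≤ x by omega)
    rw [ups_succ_of_U h] at hy
    omega

/-- Every number of down-steps smaller than the semilength is that of a point from which the path
goes down. -/
lemma exists_down {d : DyckWord} {s : ℕ} (h : s < d.semilength) :
    ∃ x, d.toList[x]? = some D ∧ downs d.toList x = s := by
  have key : ∀ y, s < downs d.toList y → ∃ x, d.toList[x]? = some D ∧ downs d.toList x = s := by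
    intro y
    induction y with
    | zero => simp [downs_zero]
    | succ y ih =>
      intro hy
      rcases lt_or_ge y d.toList.length with hl | hl
      · rcases getElem?_eq_U_or_D hl with hs | hs
        · rw [downs_succ_of_U hs] at hy
          exact ih hy
        · rw [downs_succ_of_D hs] at hy
          rcases (Nat.lt_succ_iff.mp hy).lt_or_eq with h' | h'
          · exact ih h'
          · exact ⟨y, hs, h'.symm⟩
      · apply ih
        rwa [downs_of_length_le hl, ← downs_of_length_le (show d.toList.length ≤ y + 1 by omega)]
  apply key d.toList.length
  rwa [downs_of_length_le le_rfl, ← DyckWord.semilength_eq_count_D]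

/-! ### The bounce path as a sequence of ascents -/

/-- `cs` is the sequence of ascents of the bounce path of `d` from the point `(2 * s, 0)` on. -/
def IsBounce (d : DyckWord) : ℕ → List ℕ → Prop
  | s, [] => s = d.semilength
  | s, c :: cs => 0 < c ∧ OnPath d (s + c) s ∧ d.toList[2 * s + c]? = some D ∧
      IsBounce d (s + c) cs

/-- The set whose infimum defines `ascent` is a singleton: two points with s down-steps from which
the path goes down are each the last such point. -/
lemma ascent_eq {d : DyckWord} {s c : ℕ} (h : OnPath d (s + c) s)
    (hD : d.toList[2 * s + c]? = some D) : ascent d s = c := by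
  have hx : s + c + s = 2 * s + c := by ring
  have : {c : ℕ | height d (2 * s + c) = c ∧ d.toList[2 * s + c]? = some D} = {c} := by
    ext c'
    simp only [Set.mem_ofPred_eq, Set.mem_singleton_iff]
    constructor
    · rintro ⟨h1, h2⟩
      have hl := lt_length_of_getElem? h2
      have h' : OnPath d (s + c') s := by
        apply onPath_of_height
        · omega
        · rw [show s + c' + s = 2 * s + c' by ring, h1]; push_cast; ring
      rw [OnPath, show s + c' + s = 2 * s + c' by ring] at h'
      rw [OnPath, hx] at h
      have h3 := (ups_le_of_downs_le hD (h'.2.trans h.2.symm).le).2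
      have h4 := (ups_le_of_downs_le h2 (h.2.trans h'.2.symm).le).2
      omega
    · rintro rfl
      refine ⟨?_, hD⟩
      rw [← hx, h.height_eq]; push_cast; ring
  rw [ascent, this, csInf_singleton]

/-- The point sought is the start of the down-step number s + 1. It is strictly above the axis
because the path is still nonnegative after that step. -/
lemma exists_ascent {d : DyckWord} {s : ℕ} (h : s < d.semilength) :
    ∃ c, 0 < c ∧ OnPath d (s + c) s ∧ d.toList[2 * s + c]? = some D ∧ s + c ≤ d.semilength := by
  obtain ⟨x, hx, hs⟩ := exists_down h
  have hl := lt_length_of_getElem? hx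
  have h1 := downs_le_ups d (x + 1)
  rw [downs_succ_of_D hx, ups_succ_of_D hx] at h1
  have h2 := ups_add_downs hl.le
  have h3 := ups_le_semilength d x
  refine ⟨ups d.toList x - s, by omega, ?_, ?_, by omega⟩
  · have := onPath_ups_downs hl.le
    rwa [show s + (ups d.toList x - s) = ups d.toList x by omega, ← hs]
  · rw [show 2 * s + (ups d.toList x - s) = x by omega, hx]

lemma isBounce_bounceAscents (d : DyckWord) (k s : ℕ) (hs : s ≤ d.semilength)
    (hk : d.semilength ≤ s + k) : IsBounce d s (bounceAscents d k s) := by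
  induction k generalizing s with
  | zero => simp only [bounceAscents, IsBounce]; omega
  | succ k ih =>
    rw [bounceAscents]
    split_ifs with h
    · obtain ⟨c, hc, h1, h2, h3⟩ := exists_ascent h
      rw [ascent_eq h1 h2]
      exact ⟨hc, h1, h2, ih _ h3 (by omega)⟩
    · simp only [IsBounce]; omega

lemma isBounce_bcomp (d : DyckWord) : IsBounce d 0 (bcomp d) :=
  isBounce_bounceAscents d _ 0 (Nat.zero_le _) (by omega)

lemma IsBounce.sum {d : DyckWord} {s : ℕ} {cs : List ℕ} (h : IsBounce d s cs) :
    s + cs.sum = d.semilength := by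
  induction cs generalizing s with
  | nil => simpa using! h
  | cons c cs ih => rw [List.sum_cons, ← add_assoc]; exact ih h.2.2.2

lemma IsBounce.pos {d : DyckWord} {s : ℕ} {cs : List ℕ} (h : IsBounce d s cs) :
    ∀ c ∈ cs, 0 < c := by
  induction cs generalizing s with
  | nil => simp
  | cons c cs ih =>
    rw [List.forall_mem_cons]
    exact ⟨h.1, ih h.2.2.2⟩

lemma IsBounce.unique {d : DyckWord} {s : ℕ} {cs cs' : List ℕ} (h : IsBounce d s cs)
    (h' : IsBounce d s cs') : cs = cs' := by
  induction cs generalizing s cs' with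
  | nil =>
    cases cs' with
    | nil => rfl
    | cons c cs' =>
      have h1 : s = d.semilength := h
      have h2 := h'.sum
      have h3 := h'.1
      rw [List.sum_cons] at h2
      omega
  | cons c cs ih =>
    cases cs' with
    | nil =>
      have h1 : s = d.semilength := h'
      have h2 := h.sum
      have h3 := h.1
      rw [List.sum_cons] at h2
      omega
    | cons c' cs' =>
      obtain rfl : c = c' := (ascent_eq h.2.1 h.2.2.1).symm.trans (ascent_eq h'.2.1 h'.2.2.1)
      rw [ih h.2.2.2 h'.2.2.2]

lemma IsBounce.eq_bcomp {d : DyckWord} {cs : List ℕ} (h : IsBounce d 0 cs) : bcomp d = cs :=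
  (isBounce_bcomp d).unique h

lemma bcomp_sum (d : DyckWord) : (bcomp d).sum = d.semilength := by
  simpa using (isBounce_bcomp d).sum

/-! ### Initial runs of a word, and its peaks -/

/-- The list `l` preceded by `p` up-steps and `q` down-steps. -/
def run (p q : ℕ) (l : List DyckStep) : List DyckStep :=
  List.replicate p U ++ (List.replicate q D ++ l)

section run

variable (p q : ℕ) (l : List DyckStep)

lemma count_U_run : (run p q l).count U = p + l.count U := by
  simp [run, List.count_replicate]

lemma count_D_run : (run p q l).count D = q + l.count D := by
  simp [run, List.count_replicate]

lemma run_getElem?_of_lt {i : ℕ} (h : i < p) : (run p q l)[i]? = some U := by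
  simp [run, List.getElem?_append, h]

lemma run_getElem?_of_le_of_lt {i : ℕ} (h : p ≤ i) (h' : i < p + q) :
    (run p q l)[i]? = some D := by
  rw [run, List.getElem?_append_right (by simpa using h), List.getElem?_append_left]
  · simp [List.getElem?_replicate]; omega
  · simp; omega

lemma run_getElem?_add (i : ℕ) : (run p q l)[p + q + i]? = l[i]? := by
  rw [run, List.getElem?_append_right (by simp; omega), List.getElem?_append_right (by simp; omega)]
  congr 1; simp; omega

lemma ups_run_of_le {x : ℕ} (h : x ≤ p) : ups (run p q l) x = x := by
  rw [run, ups_append_of_le _ (by simpa using h)]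
  simp [ups, List.take_replicate, h]

lemma downs_run_of_le {x : ℕ} (h : x ≤ p) : downs (run p q l) x = 0 := by
  rw [run, downs_append_of_le _ (by simpa using h)]
  simp [downs, List.take_replicate, List.count_replicate]

lemma ups_run_add_of_le {x : ℕ} (h : x ≤ q) : ups (run p q l) (p + x) = p := by
  have := ups_append (List.replicate p U) (List.replicate q D ++ l) x
  rw [ups_append_of_le (x := x) _ (by simpa only [List.length_replicate] using h)] at this
  rw [List.length_replicate] at this
  rw [run, this]
  simp [ups, List.take_replicate, List.count_replicate]

lemma downs_run_add_of_le {x : ℕ} (h : x ≤ q) : downs (run p q l) (p + x) = x := by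
  have := downs_append (List.replicate p U) (List.replicate q D ++ l) x
  rw [downs_append_of_le (x := x) _ (by simpa only [List.length_replicate] using h)] at this
  rw [List.length_replicate] at this
  rw [run, this]
  simp [downs, List.take_replicate, List.count_replicate, h]

lemma ups_run_add (x : ℕ) : ups (run p q l) (p + q + x) = p + ups l x := by
  have := ups_append (List.replicate p U) (List.replicate q D ++ l) (q + x)
  have h2 := ups_append (List.replicate q D) l x
  simp only [List.length_replicate] at this h2
  rw [run, add_assoc, this, h2]
  simp [List.count_replicate]

lemma downs_run_add (x : ℕ) : downs (run p q l) (p + q + x) = q + downs l x := by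
  have := downs_append (List.replicate p U) (List.replicate q D ++ l) (q + x)
  have h2 := downs_append (List.replicate q D) l x
  simp only [List.length_replicate] at this h2
  rw [run, add_assoc, this, h2]
  simp [List.count_replicate]

end run

/-- The positions of the up-steps that are followed by a down-step. -/
def peakIdx (l : List DyckStep) : Finset ℕ :=
  (Finset.range l.length).filter (fun i => l[i]? = some U ∧ l[i + 1]? = some D)

lemma mem_peakIdx {l : List DyckStep} {i : ℕ} :
    i ∈ peakIdx l ↔ l[i]? = some U ∧ l[i + 1]? = some D := by
  rw [peakIdx, Finset.mem_filter, Finset.mem_range]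
  exact ⟨And.right, fun h => ⟨lt_length_of_getElem? h.1, h⟩⟩

lemma mem_peakIdx_run {p q : ℕ} (hp : 0 < p) (hq : 0 < q) {l : List DyckStep} {i : ℕ} :
    i ∈ peakIdx (run p q l) ↔ i + 1 = p ∨ ∃ j ∈ peakIdx l, i = p + q + j := by
  rw [mem_peakIdx]
  constructor
  · rintro ⟨h1, h2⟩
    rcases lt_or_ge i p with hi | hi
    · left
      by_contra hne
      rw [run_getElem?_of_lt _ _ _ (by omega)] at h2
      simp at h2
    · rcases lt_or_ge i (p + q) with hi' | hi'
      · rw [run_getElem?_of_le_of_lt _ _ _ hi hi'] at h1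
        simp at h1
      · obtain ⟨j, rfl⟩ := Nat.exists_eq_add_of_le hi'
        rw [run_getElem?_add] at h1
        rw [add_assoc, run_getElem?_add] at h2
        exact Or.inr ⟨j, mem_peakIdx.mpr ⟨h1, h2⟩, rfl⟩
  · rintro (rfl | ⟨j, hj, rfl⟩)
    · exact ⟨run_getElem?_of_lt _ _ _ (by omega),
        run_getElem?_of_le_of_lt _ _ _ le_rfl (by omega)⟩
    · rw [add_assoc (p + q), run_getElem?_add, run_getElem?_add]
      exact mem_peakIdx.mp hj

lemma card_peakIdx_run {p q : ℕ} (hp : 0 < p) (hq : 0 < q) (l : List DyckStep) :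
    (peakIdx (run p q l)).card = (peakIdx l).card + 1 := by
  have : peakIdx (run p q l) = insert (p - 1) ((peakIdx l).map (addLeftEmbedding (p + q))) := by
    ext i
    rw [mem_peakIdx_run hp hq, Finset.mem_insert, Finset.mem_map]
    simp only [addLeftEmbedding_apply]
    constructor
    · rintro (h | ⟨j, hj, rfl⟩)
      · left; omega
      · exact Or.inr ⟨j, hj, rfl⟩
    · rintro (h | ⟨j, hj, rfl⟩)
      · left; omega
      · exact Or.inr ⟨j, hj, rfl⟩
  rw [this, Finset.card_insert_of_notMem, Finset.card_map]
  simp only [Finset.mem_map, addLeftEmbedding_apply, not_exists, not_and]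
  intro x _; omega

lemma pk_eq (d : DyckWord) : pk d = (peakIdx d.toList).card := by
  rw [pk, peaks, Finset.card_image_of_injective]
  · rfl
  · intro i j h
    simpa using (Prod.ext_iff.mp h).1

lemma mem_peaks {d : DyckWord} {P : ℕ × ℤ} :
    P ∈ peaks d ↔ ∃ i ∈ peakIdx d.toList, (i + 1, height d (i + 1)) = P := by
  rw [peaks, Finset.mem_image]; rfl

/-! ### Concatenated pyramids -/

/-- The concatenation of pyramids of the given heights. -/
def pyramids (cs : List ℕ) : DyckWord := (cs.map pyramid).sum

lemma toList_pyramid (c : ℕ) : (pyramid c).toList = List.replicate c U ++ List.replicate c D := by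
  induction c with
  | zero => rfl
  | succ c ih =>
    rw [pyramid, Function.iterate_succ_apply', ← pyramid]
    simp only [DyckWord.nest, ih]
    rw [List.replicate_succ, List.replicate_succ']
    simp

lemma toList_pyramids_nil : (pyramids []).toList = [] := rfl

lemma toList_pyramids_cons (c : ℕ) (cs : List ℕ) :
    (pyramids (c :: cs)).toList = run c c (pyramids cs).toList := by
  have : (pyramids (c :: cs)).toList = (pyramid c).toList ++ (pyramids cs).toList := rfl
  rw [this, toList_pyramid, run, List.append_assoc]

lemma semilength_pyramids (cs : List ℕ) : (pyramids cs).semilength = cs.sum := by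
  induction cs with
  | nil => rfl
  | cons c cs ih =>
    rw [DyckWord.semilength, toList_pyramids_cons, count_U_run, ← DyckWord.semilength, ih,
      List.sum_cons]

lemma pk_pyramids {cs : List ℕ} (h : ∀ c ∈ cs, 0 < c) : pk (pyramids cs) = cs.length := by
  induction cs with
  | nil => rfl
  | cons c cs ih =>
    rw [List.forall_mem_cons] at h
    rw [pk_eq, toList_pyramids_cons, card_peakIdx_run h.1 h.1, ← pk_eq, ih h.2, List.length_cons]

lemma height_pyramids_cons_add (c : ℕ) (cs : List ℕ) (x : ℕ) :
    height (pyramids (c :: cs)) (c + c + x) = height (pyramids cs) x := by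
  rw [height_eq, height_eq, toList_pyramids_cons, ups_run_add, downs_run_add]
  push_cast; ring

lemma valley_pyramids {cs : List ℕ} {P : ℕ × ℤ} (hP : P ∈ valleys (pyramids cs)) : P.2 = 0 := by
  rw [valleys, Finset.mem_image] at hP
  obtain ⟨i, hi, rfl⟩ := hP
  rw [Finset.mem_filter] at hi
  obtain ⟨-, h1, h2⟩ := hi
  simp only
  induction cs generalizing i with
  | nil => simp [toList_pyramids_nil] at h1
  | cons c cs ih =>
    rw [toList_pyramids_cons] at h1 h2
    rcases lt_or_ge i (c + c) with hi | hi
    · have : i + 1 = c + c + 0 := by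
        by_contra hne
        rcases lt_or_ge i c with hc | hc
        · rw [run_getElem?_of_lt _ _ _ hc] at h1
          simp at h1
        · rw [run_getElem?_of_le_of_lt _ _ _ (by omega) (by omega)] at h2
          simp at h2
      rw [this, height_pyramids_cons_add]
      simp [height]
    · obtain ⟨j, rfl⟩ := Nat.exists_eq_add_of_le hi
      rw [run_getElem?_add] at h1
      rw [add_assoc, run_getElem?_add] at h2
      rw [add_assoc, height_pyramids_cons_add]
      exact ih j h1 h2

/-! ### Pyramids with their peaks on `d` as elements of `B d` -/

/-- The peaks of `pyramids cs`, placed at `(2 * s, 0)`, are points of `d`. -/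
def PeaksOn (d : DyckWord) : ℕ → List ℕ → Prop
  | s, [] => s = d.semilength
  | s, c :: cs => 0 < c ∧ OnPath d (s + c) s ∧ PeaksOn d (s + c) cs

lemma IsBounce.peaksOn {d : DyckWord} {s : ℕ} {cs : List ℕ} (h : IsBounce d s cs) :
    PeaksOn d s cs := by
  induction cs generalizing s with
  | nil => exact h
  | cons c cs ih => exact ⟨h.1, h.2.1, ih h.2.2.2⟩

lemma PeaksOn.sum {d : DyckWord} {s : ℕ} {cs : List ℕ} (h : PeaksOn d s cs) :
    s + cs.sum = d.semilength := by
  induction cs generalizing s with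
  | nil => simpa using! h
  | cons c cs ih => rw [List.sum_cons, ← add_assoc]; exact ih h.2.2

lemma PeaksOn.pos {d : DyckWord} {s : ℕ} {cs : List ℕ} (h : PeaksOn d s cs) :
    ∀ c ∈ cs, 0 < c := by
  induction cs generalizing s with
  | nil => simp
  | cons c cs ih =>
    rw [List.forall_mem_cons]
    exact ⟨h.1, ih h.2.2⟩

/-- The height of `d` changes by at most one per step, so on both sides of a peak shared with `d`
the slopes of the pyramid stay below `d`. -/
lemma PeaksOn.height_pyramids_le {d : DyckWord} {s : ℕ} {cs : List ℕ} (h : PeaksOn d s cs)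
    (x : ℕ) : height (pyramids cs) x ≤ height d (2 * s + x) := by
  induction cs generalizing s x with
  | nil =>
    rw [height_of_length_le (by simp [toList_pyramids_nil])]
    exact height_nonneg _ _
  | cons c cs ih =>
    obtain ⟨-, hc, hcs⟩ := h
    have hh := hc.height_eq
    rw [show s + c + s = 2 * s + c by ring] at hh
    rcases le_or_gt x c with hx | hx
    · rw [height_eq (pyramids _), toList_pyramids_cons, ups_run_of_le _ _ _ hx,
        downs_run_of_le _ _ _ hx]
      have := abs_height_add_sub d (2 * s + x) (c - x)
      rw [add_assoc, Nat.add_sub_cancel' hx, hh, abs_le] at this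
      push_cast [hx] at *
      omega
    · rcases le_or_gt x (c + c) with hx' | hx'
      · obtain ⟨y, rfl⟩ := Nat.exists_eq_add_of_le hx.le
        rw [height_eq (pyramids _), toList_pyramids_cons, ups_run_add_of_le _ _ _ (by omega),
          downs_run_add_of_le _ _ _ (by omega)]
        have := abs_height_add_sub d (2 * s + c) y
        rw [hh, abs_le] at this
        rw [← add_assoc]
        push_cast at *
        omega
      · obtain ⟨y, rfl⟩ := Nat.exists_eq_add_of_le hx'.le
        rw [height_pyramids_cons_add]
        convert ih hcs y using 2
        ring

lemma PeaksOn.height_eq_of_mem_peakIdx {d : DyckWord} {s : ℕ} {cs : List ℕ} (h : PeaksOn d s cs)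
    {i : ℕ} (hi : i ∈ peakIdx (pyramids cs).toList) :
    height d (2 * s + (i + 1)) = height (pyramids cs) (i + 1) := by
  induction cs generalizing s i with
  | nil => simp [toList_pyramids_nil, peakIdx] at hi
  | cons c cs ih =>
    obtain ⟨h0, hc, hcs⟩ := h
    rw [toList_pyramids_cons, mem_peakIdx_run h0 h0] at hi
    rcases hi with hi | ⟨j, hj, rfl⟩
    · have hh := hc.height_eq
      rw [show s + c + s = 2 * s + c by ring] at hh
      rw [hi, hh, height_eq, toList_pyramids_cons, ups_run_of_le _ _ _ le_rfl,
        downs_run_of_le _ _ _ le_rfl]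
      push_cast; ring
    · rw [add_assoc, height_pyramids_cons_add, ← ih hcs hj]
      congr 1; ring

lemma bounce_eq (d : DyckWord) : bounce d = pyramids (bcomp d) := rfl

/-- Source of both `bounce d` and the second element in the non-unique case. The valleys impose
nothing, since they all lie on the axis. -/
lemma PeaksOn.mem_B {d : DyckWord} {cs : List ℕ} (h : PeaksOn d 0 cs)
    (hl : cs.length = (bcomp d).length) : pyramids cs ∈ B d := by
  refine ⟨?_, fun x => ?_, ?_, ?_, fun P hP => Or.inr (valley_pyramids hP)⟩
  · rw [semilength_pyramids, ← h.sum, zero_add]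
  · simpa using h.height_pyramids_le x
  · rw [bounce_eq, pk_pyramids h.pos, pk_pyramids (isBounce_bcomp d).pos, hl]
  · intro P hP
    obtain ⟨i, hi, rfl⟩ := mem_peaks.mp hP
    simpa using h.height_eq_of_mem_peakIdx hi

lemma bounce_mem_B (d : DyckWord) : bounce d ∈ B d := (isBounce_bcomp d).peaksOn.mem_B rfl

lemma takeWhile_run {p q : ℕ} (hq : 0 < q) (l : List DyckStep) :
    (run p q l).takeWhile (· = U) = List.replicate p U := by
  obtain ⟨q, rfl⟩ := Nat.exists_eq_add_of_lt hq
  simp [run, List.replicate_succ]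

/-- The initial run of up-steps reveals the first entry, which can then be cancelled. -/
lemma pyramids_injOn {cs cs' : List ℕ} (h : ∀ c ∈ cs, 0 < c) (h' : ∀ c ∈ cs', 0 < c)
    (he : pyramids cs = pyramids cs') : cs = cs' := by
  induction cs generalizing cs' with
  | nil =>
    cases cs' with
    | nil => rfl
    | cons c' cs' =>
      have := congrArg DyckWord.semilength he
      rw [List.forall_mem_cons] at h'
      rw [semilength_pyramids, semilength_pyramids, List.sum_cons, List.sum_nil] at this
      omega
  | cons c cs ih =>
    rw [List.forall_mem_cons] at h
    cases cs' with
    | nil =>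
      have := congrArg DyckWord.semilength he
      rw [semilength_pyramids, semilength_pyramids, List.sum_cons, List.sum_nil] at this
      omega
    | cons c' cs' =>
      rw [List.forall_mem_cons] at h'
      have h1 := congrArg DyckWord.toList he
      rw [toList_pyramids_cons, toList_pyramids_cons] at h1
      have h2 := congrArg (fun l => (l.takeWhile (· = U)).length) h1
      simp only [takeWhile_run h.1, takeWhile_run h'.1, List.length_replicate] at h2
      subst h2
      simp only [run, List.append_cancel_left_eq] at h1
      rw [ih h.2 h'.2 (DyckWord.ext h1)]

/-! ### Bounce peaks that are peaks of `d` -/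

/-- Each peak of `pyramids cs`, placed at `(2 * s, 0)`, is at the end of an up-step of `d`. -/
def UpBefore (d : DyckWord) : ℕ → List ℕ → Prop
  | _, [] => True
  | s, c :: cs => d.toList[2 * s + c - 1]? = some U ∧ UpBefore d (s + c) cs

/-- At a bounce peak `d` goes down by construction, so only the preceding step decides whether it is
a peak of `d`. -/
lemma IsBounce.upBefore_iff {d : DyckWord} {s : ℕ} {cs : List ℕ} (h : IsBounce d s cs) :
    UpBefore d s cs ↔
      ∀ i ∈ peakIdx (pyramids cs).toList, 2 * s + i ∈ peakIdx d.toList := by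
  induction cs generalizing s with
  | nil => simp [UpBefore, peakIdx, toList_pyramids_nil]
  | cons c cs ih =>
    obtain ⟨hc, h1, h2, h3⟩ := h
    rw [UpBefore, toList_pyramids_cons, ih h3]
    simp only [mem_peakIdx_run hc hc]
    constructor
    · rintro ⟨hU, hcs⟩ i (rfl | ⟨j, hj, rfl⟩)
      · exact mem_peakIdx.mpr ⟨hU, h2⟩
      · convert hcs j hj using 1; ring
    · intro hi
      constructor
      · have := (mem_peakIdx.mp (hi (c - 1) (Or.inl (by omega)))).1
        rwa [← Nat.add_sub_assoc hc] at this
      · intro j hj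
        convert hi (c + c + j) (Or.inr ⟨j, hj, rfl⟩) using 1; ring

lemma peaks_bounce_subset_iff (d : DyckWord) :
    peaks (bounce d) ⊆ peaks d ↔ UpBefore d 0 (bcomp d) := by
  rw [(isBounce_bcomp d).upBefore_iff, ← bounce_eq]
  have key : ∀ i ∈ peakIdx (bounce d).toList, height d (i + 1) = height (bounce d) (i + 1) :=
    fun i hi => by simpa using! (isBounce_bcomp d).peaksOn.height_eq_of_mem_peakIdx hi
  constructor
  · intro h i hi
    obtain ⟨j, hj, he⟩ := mem_peaks.mp (h (mem_peaks.mpr ⟨i, hi, rfl⟩))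
    obtain rfl : j = i := by simpa using (Prod.ext_iff.mp he).1
    simpa using hj
  · intro h P hP
    obtain ⟨i, hi, rfl⟩ := mem_peaks.mp hP
    exact mem_peaks.mpr ⟨i, by simpa using h i hi, by rw [key i hi]⟩

/-! ### Uniqueness in `B d` when the bounce peaks are peaks of `d` -/

lemma exists_replicate_append (s : DyckStep) (l : List DyckStep) :
    ∃ p l', l = List.replicate p s ++ l' ∧ l'.head? ≠ some s := by
  induction l with
  | nil => exact ⟨0, [], rfl, by simp⟩
  | cons t l ih =>
    by_cases h : t = s
    · obtain ⟨p, l', rfl, hl⟩ := ih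
      exact ⟨p + 1, l', by simp [List.replicate_succ, h], hl⟩
    · exact ⟨0, t :: l, rfl, by simpa using h⟩

lemma exists_run {l : List DyckStep} (hl : l ≠ []) (hh : l.head? ≠ some D)
    (hD : 0 < l.count D) :
    ∃ p q l', 0 < p ∧ 0 < q ∧ l'.head? ≠ some D ∧ l = run p q l' := by
  obtain ⟨p, l₁, rfl, h₁⟩ := exists_replicate_append U l
  obtain ⟨q, l₂, rfl, h₂⟩ := exists_replicate_append D l₁
  have hne : List.replicate q D ++ l₂ ≠ [] := by
    intro h
    rw [h] at hD
    simp [List.count_replicate] at hD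
  refine ⟨p, q, l₂, ?_, ?_, h₂, rfl⟩
  · rcases Nat.eq_zero_or_pos p with rfl | h
    · rcases hs : (List.replicate q D ++ l₂) with _ | ⟨s, t⟩
      · exact absurd hs hne
      · rw [hs] at h₁ hh
        rcases s.dichotomy with rfl | rfl <;> simp at h₁ hh
    · exact h
  · rcases Nat.eq_zero_or_pos q with rfl | h
    · rcases hs : l₂ with _ | ⟨s, t⟩
      · simp [hs] at hne
      · rw [hs] at h₁ h₂
        rcases s.dichotomy with rfl | rfl <;> simp at h₁ h₂
    · exact h

/-- A path from `(u + v, u - v)` to the end of `d` which has its peaks on `d`, and no more peaks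
than the bounce path from `(2 * s, 0)` on, is this bounce path, if `u ≤ s` and the peaks of the
bounce path are peaks of `d`. -/
lemma IsBounce.eq_pyramids {d : DyckWord} {s : ℕ} {cs : List ℕ} (hb : IsBounce d s cs)
    (hup : UpBefore d s cs) {l : List DyckStep} {u v : ℕ} (hvu : v ≤ u) (hus : u ≤ s)
    (hh : l.head? ≠ some D) (hl : ∀ x, v + downs l x ≤ u + ups l x)
    (hU : u + l.count U = d.semilength) (hD : v + l.count D = d.semilength)
    (hon : ∀ i ∈ peakIdx l, OnPath d (u + ups l (i + 1)) (v + downs l (i + 1)))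
    (hcard : (peakIdx l).card ≤ cs.length) :
    u = s ∧ v = s ∧ l = (pyramids cs).toList := by
  induction cs generalizing s l u v with
  | nil =>
    have hs : s = d.semilength := hb
    by_cases hne : l = []
    · subst hne
      simp only [List.count_nil] at hU hD
      exact ⟨by omega, by omega, rfl⟩
    · by_cases h0 : l.count D = 0
      · have h1 := count_U_add_count_D l
        have := List.length_pos_iff.mpr hne
        omega
      · obtain ⟨p, q, l', hp, hq, -, rfl⟩ := exists_run hne hh (by omega)
        rw [card_peakIdx_run hp hq] at hcard
        simp at hcard
  | cons c cs ih =>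
    have hsum := hb.sum
    obtain ⟨hc, h1, h2, h3⟩ := hb
    obtain ⟨hup1, hup2⟩ := hup
    rw [List.sum_cons] at hsum
    by_cases hne : l = []
    · subst hne
      simp only [List.count_nil] at hU hD
      omega
    · by_cases h0 : l.count D = 0
      · have h1 := count_U_add_count_D l
        have := List.length_pos_iff.mpr hne
        omega
      · obtain ⟨p, q, l', hp, hq, hh', rfl⟩ := exists_run hne hh (by omega)
        rw [card_peakIdx_run hp hq, List.length_cons] at hcard
        rw [count_U_run] at hU
        rw [count_D_run] at hD
        have hpk := hon (p - 1) ((mem_peakIdx_run hp hq).mpr (Or.inl (by omega)))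
        rw [Nat.sub_add_cancel hp, ups_run_of_le _ _ _ le_rfl, downs_run_of_le _ _ _ le_rfl,
          add_zero] at hpk
        have hx : s + c + s = 2 * s + c := by ring
        rw [OnPath, hx] at h1
        have hle : v + q ≤ u + p := by
          have := hl (p + q + 0)
          rw [ups_run_add, downs_run_add, ups_zero, downs_zero] at this
          omega
        -- The peak (u + p, v) is on `d` and v ≤ s, while the bounce peak is the last point of `d`
        -- with s down-steps; so u + p ≤ s + c. The path is still not ahead, and induction applies
        -- after its first run.
        have hle2 := (ups_le_of_downs_le h2 (y := u + p + v) (by rw [hpk.2, h1.2]; omega)).1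
        rw [hpk.1, h1.1] at hle2
        obtain ⟨e1, e2, e3⟩ := ih h3 hup2 hle hle2 hh'
          (fun x => by
            have := hl (p + q + x)
            rw [ups_run_add, downs_run_add] at this
            omega)
          (by omega) (by omega)
          (fun i hi => by
            have := hon (p + q + i) ((mem_peakIdx_run hp hq).mpr (Or.inr ⟨i, hi, rfl⟩))
            rwa [add_assoc (p + q), ups_run_add, downs_run_add, ← add_assoc, ← add_assoc] at this)
          (by omega)
        have hxc : 2 * s + c - 1 + 1 = 2 * s + c := by omega
        -- Induction forces u + p = s + c. The bounce peak follows an up-step, so it is the first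
        -- point of `d` with s + c up-steps, whence s ≤ v; with v ≤ u ≤ s all three agree.
        have hle3 := downs_le_of_ups_le hup1 (y := u + p + v)
          (by rw [hxc, h1.1, hpk.1, e1])
        rw [hxc, h1.2, hpk.2] at hle3
        obtain rfl : v = s := by omega
        obtain rfl : u = v := by omega
        obtain rfl : p = c := by omega
        obtain rfl : q = p := by omega
        refine ⟨rfl, rfl, ?_⟩
        rw [toList_pyramids_cons, e3]

lemma head?_toList_ne (b : DyckWord) : b.toList.head? ≠ some D := by
  intro h
  have := downs_le_ups b 1
  rcases hb : b.toList with _ | ⟨s, t⟩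
  · simp [hb] at h
  · rw [hb] at h
    simp only [List.head?_cons, Option.some.injEq] at h
    rw [hb, h] at this
    simp [ups, downs] at this

lemma eq_bounce_of_mem_B {d b : DyckWord} (hd : peaks (bounce d) ⊆ peaks d) (hb : b ∈ B d) :
    b = bounce d := by
  rw [peaks_bounce_subset_iff] at hd
  obtain ⟨h1, -, h3, h4, -⟩ := hb
  rw [bounce_eq, pk_pyramids (isBounce_bcomp d).pos, pk_eq] at h3
  apply DyckWord.ext
  refine ((isBounce_bcomp d).eq_pyramids hd (u := 0) (v := 0) le_rfl le_rfl (head?_toList_ne b)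
    (fun x => ?_) ?_ ?_ (fun i hi => ?_) h3.le).2.2
  · simpa using downs_le_ups b x
  · rw [zero_add, ← h1]; rfl
  · rw [zero_add, ← h1, DyckWord.semilength_eq_count_D]
  · have hlt := lt_length_of_getElem? (mem_peakIdx.mp hi).1
    have hh : height d (i + 1) = height b (i + 1) := h4 _ (mem_peaks.mpr ⟨i, hi, rfl⟩)
    have hs := ups_add_downs (l := b.toList) (x := i + 1) hlt
    rw [zero_add, zero_add]
    apply onPath_of_height
    · rw [hs, length_toList, ← h1, ← length_toList]; exact hlt
    · rw [hs, hh, height_eq]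

/-! ### A second element of `B d` otherwise -/

/-- If a peak of the bounce path, other than the first one, is not a peak of `d`, then the peak
before it can be lowered and the peak itself raised. -/
lemma IsBounce.exists_peaksOn_ne {d : DyckWord} {s c : ℕ} {cs : List ℕ}
    (hb : IsBounce d s (c :: cs)) (hU : d.toList[2 * s + c - 1]? = some U)
    (hup : ¬ UpBefore d (s + c) cs) :
    ∃ cs', cs' ≠ c :: cs ∧ cs'.length = (c :: cs).length ∧ PeaksOn d s cs' := by
  induction cs generalizing s c with
  | nil => exact absurd trivial hup
  | cons c' cs ih =>
    obtain ⟨hc, h1, h2, h3⟩ := hb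
    by_cases hU' : d.toList[2 * (s + c) + c' - 1]? = some U
    · obtain ⟨cs', hne, hlen, hon⟩ := ih h3 hU' (fun h => hup ⟨hU', h⟩)
      exact ⟨c :: cs', by simpa using hne, by simpa using hlen, hc, h1, hon⟩
    · obtain ⟨hc', h1', h2', h3'⟩ := h3
      have hx : s + c + s = 2 * s + c := by ring
      have hx' : s + c + c' + (s + c) = 2 * (s + c) + c' := by ring
      rw [OnPath, hx] at h1
      rw [OnPath, hx'] at h1'
      have hlt := lt_length_of_getElem? h2'
      have hD := (getElem?_eq_U_or_D (l := d.toList) (x := 2 * (s + c) + c' - 1)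
        (by omega)).resolve_left hU'
      have e1 := ups_succ_of_D hD
      have e2 := downs_succ_of_D hD
      rw [Nat.sub_add_cancel (by omega)] at e1 e2
      have e3 := ups_succ_of_U hU
      have e4 := downs_succ_of_U hU
      rw [Nat.sub_add_cancel (by omega)] at e3 e4
      -- The lowered peak must stay positive. If c = 1, the point just before the next bounce peak
      -- would have only s down-steps, although it comes after the last such point.
      have hc2 : 2 ≤ c := by
        by_contra hlt2
        have h4 := (ups_le_of_downs_le h2 (y := 2 * (s + c) + c' - 1) (by omega)).2
        omega
      -- The new peaks are the points of `d` one step before the two old ones: an up-step is undone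
      -- at the first, a down-step at the second. The sum is unchanged, so the remaining peaks stay
      -- in place.
      refine ⟨(c - 1) :: (c' + 1) :: cs, ?_, by simp, by omega, ?_, by omega, ?_, ?_⟩
      · intro h
        simp only [List.cons.injEq] at h
        omega
      · rw [OnPath, show s + (c - 1) + s = 2 * s + c - 1 by omega]
        omega
      · rw [OnPath, show s + (c - 1) + (c' + 1) + (s + (c - 1)) = 2 * (s + c) + c' - 1 by omega]
        omega
      · rw [show s + (c - 1) + (c' + 1) = s + c + c' by omega]
        exact IsBounce.peaksOn h3'

lemma exists_mem_B_ne_bounce {d : DyckWord} (hd : ¬ peaks (bounce d) ⊆ peaks d) :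
    ∃ b ∈ B d, b ≠ bounce d := by
  rw [peaks_bounce_subset_iff] at hd
  have hb := isBounce_bcomp d
  rcases hcs : bcomp d with _ | ⟨c, cs⟩
  · rw [hcs] at hd
    exact absurd trivial hd
  · rw [hcs] at hd hb
    -- The first bounce peak always follows an up-step, as no down-step precedes it.
    have hU : d.toList[2 * 0 + c - 1]? = some U := by
      obtain ⟨hc, h1, h2, -⟩ := hb
      have hlt := lt_length_of_getElem? h2
      refine (getElem?_eq_U_or_D (l := d.toList) (x := 2 * 0 + c - 1)
        (by omega)).resolve_right fun hD => ?_
      have e2 := downs_succ_of_D hD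
      rw [show 2 * 0 + c - 1 + 1 = 0 + c + 0 by omega, h1.2] at e2
      omega
    obtain ⟨cs', hne, hlen, hon⟩ := hb.exists_peaksOn_ne hU (fun h => hd ⟨hU, h⟩)
    refine ⟨pyramids cs', hon.mem_B (by rw [hlen, hcs]), fun h => hne ?_⟩
    rw [bounce_eq, hcs] at h
    exact pyramids_injOn hon.pos hb.pos h

theorem ncard_B_eq_one_iff (d : DyckWord) :
    (B d).ncard = 1 ↔ peaks (bounce d) ⊆ peaks d := by
  rw [Set.ncard_eq_one]
  constructor
  · rintro ⟨a, ha⟩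
    by_contra hd
    obtain ⟨b, hb, hne⟩ := exists_mem_B_ne_bounce hd
    have h := bounce_mem_B d
    rw [ha, Set.mem_singleton_iff] at hb h
    exact hne (hb.trans h.symm)
  · intro hd
    refine ⟨bounce d, Set.eq_singleton_iff_unique_mem.mpr ⟨bounce_mem_B d, fun b hb => ?_⟩⟩
    exact eq_bounce_of_mem_B hd hb

/-! ### Counting the paths with a given bounce composition -/

/-- The words with `p` down-steps and `q` up-steps. -/
def words : ℕ → ℕ → Finset (List DyckStep)
  | 0, q => {List.replicate q U}
  | p + 1, 0 => {List.replicate (p + 1) D}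
  | p + 1, q + 1 => (words p (q + 1)).image (D :: ·) ∪ (words (p + 1) q).image (U :: ·)

lemma eq_replicate_of_count_U_eq_zero {w : List DyckStep} (h : w.count U = 0) :
    w = List.replicate w.length D := by
  rw [List.eq_replicate_iff]
  refine ⟨rfl, fun s hs => ?_⟩
  rcases s.dichotomy with rfl | rfl
  · exact absurd hs (List.count_eq_zero.mp h)
  · rfl

lemma eq_replicate_of_count_D_eq_zero {w : List DyckStep} (h : w.count D = 0) :
    w = List.replicate w.length U := by
  rw [List.eq_replicate_iff]
  refine ⟨rfl, fun s hs => ?_⟩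
  rcases s.dichotomy with rfl | rfl
  · rfl
  · exact absurd hs (List.count_eq_zero.mp h)

lemma mem_words {p q : ℕ} {w : List DyckStep} :
    w ∈ words p q ↔ w.count D = p ∧ w.count U = q := by
  have hlen := count_U_add_count_D w
  induction p, q using words.induct generalizing w with
  | case1 q =>
    rw [words, Finset.mem_singleton]
    constructor
    · rintro rfl; simp [List.count_replicate]
    · rintro ⟨h1, h2⟩
      rw [eq_replicate_of_count_D_eq_zero h1]; congr 1; omega
  | case2 p =>
    rw [words, Finset.mem_singleton]
    constructor
    · rintro rfl; simp [List.count_replicate]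
    · rintro ⟨h1, h2⟩
      rw [eq_replicate_of_count_U_eq_zero h2]; congr 1; omega
  | case3 p q ih1 ih2 =>
    rw [words, Finset.mem_union, Finset.mem_image, Finset.mem_image]
    constructor
    · rintro (⟨w, hw, rfl⟩ | ⟨w, hw, rfl⟩)
      · have := (ih1 (count_U_add_count_D w)).mp hw
        simpa using this
      · have := (ih2 (count_U_add_count_D w)).mp hw
        simpa using this
    · intro h
      rcases w with _ | ⟨s, w⟩
      · simp at h
      · rcases s.dichotomy with rfl | rfl
        · exact Or.inr ⟨w, (ih2 (count_U_add_count_D w)).mpr (by simpa using h), rfl⟩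
        · exact Or.inl ⟨w, (ih1 (count_U_add_count_D w)).mpr (by simpa using h), rfl⟩

lemma card_words (p q : ℕ) : (words p q).card = (p + q).choose q := by
  induction p, q using words.induct with
  | case1 q => simp [words]
  | case2 p => simp [words]
  | case3 p q ih1 ih2 =>
    rw [words, Finset.card_union_of_disjoint, Finset.card_image_of_injective _ List.cons_injective,
      Finset.card_image_of_injective _ List.cons_injective, ih1, ih2,
      show p + 1 + (q + 1) = (p + 1 + q) + 1 by ring, Nat.choose_succ_succ,
      show p + (q + 1) = p + 1 + q by ring, add_comm]
    rw [Finset.disjoint_left]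
    intro w h1 h2
    rw [Finset.mem_image] at h1 h2
    obtain ⟨w₁, -, rfl⟩ := h1
    obtain ⟨w₂, -, h⟩ := h2
    simp at h

/-- The product of `(cᵢ + cᵢ₊₁ - 2).choose (cᵢ₊₁ - 1)` over the pairs of consecutive entries. -/
def listWeight (cs : List ℕ) : ℕ :=
  (List.zipWith (fun a b => (a + b - 2).choose (b - 1)) cs cs.tail).prod

lemma weight_eq {n : ℕ} (c : Composition n) : weight c = listWeight c.blocks := rfl

lemma listWeight_nil : listWeight [] = 1 := rfl

lemma listWeight_singleton (a : ℕ) : listWeight [a] = 1 := rfl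

lemma listWeight_cons_cons (a b : ℕ) (cs : List ℕ) :
    listWeight (a :: b :: cs) = (a + b - 2).choose (b - 1) * listWeight (b :: cs) := by
  simp [listWeight]

/-- What follows the first ascent, of length `a`, in the paths whose bounce path has the ascents
`a :: cs` and whose peaks include those of the bounce path. -/
def tails : ℕ → List ℕ → Finset (List DyckStep)
  | a, [] => {List.replicate a D}
  | a, b :: cs => (words (a - 1) (b - 1) ×ˢ tails b cs).image (fun x => D :: (x.1 ++ U :: x.2))

lemma card_tails {a : ℕ} {cs : List ℕ} (ha : 0 < a) (h : ∀ c ∈ cs, 0 < c) :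
    (tails a cs).card = listWeight (a :: cs) := by
  induction cs generalizing a with
  | nil => rfl
  | cons b cs ih =>
    rw [List.forall_mem_cons] at h
    rw [tails, Finset.card_image_of_injOn, Finset.card_product, ih h.1 h.2, card_words,
      listWeight_cons_cons]
    · congr 2; omega
    · rintro ⟨w, t⟩ hx ⟨w', t'⟩ hx' he
      simp only [Finset.coe_product, Set.mem_prod, Finset.mem_coe, mem_words] at hx hx'
      simp only [List.cons.injEq, true_and] at he
      have h1 := count_U_add_count_D w
      have h2 := count_U_add_count_D w'
      -- Both words have length (a - 1) + (b - 1), so the place of the cut is determined.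
      obtain ⟨rfl, h⟩ := List.append_inj he (by omega)
      simp only [List.cons.injEq, true_and] at h
      rw [h]

lemma mem_tails_cons {a b : ℕ} {cs : List ℕ} {t : List DyckStep} :
    t ∈ tails a (b :: cs) ↔ ∃ w t', (w.count D = a - 1 ∧ w.count U = b - 1) ∧ t' ∈ tails b cs ∧
      t = (D :: (w ++ [U])) ++ t' := by
  rw [tails, Finset.mem_image]
  constructor
  · rintro ⟨⟨w, t'⟩, h, rfl⟩
    rw [Finset.mem_product, mem_words] at h
    exact ⟨w, t', h.1, h.2, by simp⟩
  · rintro ⟨w, t', h1, h2, rfl⟩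
    exact ⟨(w, t'), Finset.mem_product.mpr ⟨mem_words.mpr h1, h2⟩, by simp⟩

/-- Nonnegativity is automatic: a block D w U starts at height a and contains exactly a down-steps
in all, so w needs no constraint. -/
lemma tails_properties {a : ℕ} {cs : List ℕ} {t : List DyckStep} (ha : 0 < a)
    (h : ∀ c ∈ cs, 0 < c) (ht : t ∈ tails a cs) :
    t.count U = cs.sum ∧ t.count D = a + cs.sum ∧ ∀ x, downs t x ≤ a + ups t x := by
  induction cs generalizing a t with
  | nil =>
    rw [tails, Finset.mem_singleton] at ht
    subst ht
    refine ⟨by simp [List.count_replicate], by simp, fun x => ?_⟩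
    have : downs (List.replicate a D) x ≤ a := by simp [downs, List.take_replicate]
    omega
  | cons b cs ih =>
    rw [List.forall_mem_cons] at h
    obtain ⟨w, t', ⟨h1, h2⟩, h3, rfl⟩ := mem_tails_cons.mp ht
    obtain ⟨i1, i2, i3⟩ := ih h.1 h.2 h3
    have eD : (D :: (w ++ [U])).count D = a := by simp [h1]; omega
    have eU : (D :: (w ++ [U])).count U = b := by simp [h2]; omega
    rw [List.count_append, List.count_append, eD, eU, i1, i2, List.sum_cons]
    refine ⟨rfl, rfl, fun x => ?_⟩
    rcases le_or_gt x (D :: (w ++ [U])).length with hx | hx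
    · rw [downs_append_of_le _ hx]
      have := (List.take_sublist x (D :: (w ++ [U]))).count_le D
      rw [eD] at this
      exact this.trans (Nat.le_add_right _ _)
    · obtain ⟨y, rfl⟩ := Nat.exists_eq_add_of_le hx.le
      rw [downs_append, ups_append, eD, eU]
      have := i3 y
      omega

lemma count_take_drop (l : List DyckStep) (s : DyckStep) (x k : ℕ) :
    (l.take x).count s + ((l.drop x).take k).count s = (l.take (x + k)).count s := by
  rw [List.take_add, List.count_append]

lemma count_drop (l : List DyckStep) (s : DyckStep) (x : ℕ) :
    (l.take x).count s + (l.drop x).count s = l.count s := by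
  rw [← List.count_append, List.take_append_drop]

lemma drop_eq_cons {l : List DyckStep} {s : DyckStep} {x : ℕ} (h : l[x]? = some s) :
    l.drop x = s :: l.drop (x + 1) := by
  obtain ⟨hx, rfl⟩ := List.getElem?_eq_some_iff.mp h
  exact List.drop_eq_getElem_cons hx

/-- From the bounce peak (s + c, s) to the next one (s + c + b, s + c) there are c down-steps and b
up-steps. The first step is D and the last is U, which leaves the counts required of w. -/
lemma IsBounce.drop_mem_tails {d : DyckWord} {s c : ℕ} {cs : List ℕ}
    (hb : IsBounce d s (c :: cs)) (hup : UpBefore d (s + c) cs) :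
    d.toList.drop (2 * s + c) ∈ tails c cs := by
  induction cs generalizing s c with
  | nil =>
    obtain ⟨hc, h1, h2, h3⟩ := hb
    have h3 : s + c = d.semilength := h3
    rw [OnPath, show s + c + s = 2 * s + c by ring] at h1
    have h4 := count_drop d.toList U (2 * s + c)
    have h5 : (d.toList.take (2 * s + c)).count U = s + c := h1.1
    have h6 : d.toList.count U = d.semilength := rfl
    rw [tails, Finset.mem_singleton, eq_replicate_of_count_U_eq_zero
      (show (d.toList.drop (2 * s + c)).count U = 0 by omega), List.length_drop, length_toList]
    congr 1; omega
  | cons b cs ih =>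
    obtain ⟨hc, h1, h2, h3⟩ := hb
    have ht := ih h3 hup.2
    obtain ⟨hb, h1', h2', -⟩ := h3
    have hU := hup.1
    rw [OnPath, show s + c + s = 2 * s + c by ring] at h1
    rw [OnPath, show s + c + b + (s + c) = 2 * (s + c) + b by ring] at h1'
    have e1 := ups_succ_of_D h2
    have e2 := downs_succ_of_D h2
    have e3 := ups_succ_of_U hU
    have e4 := downs_succ_of_U hU
    rw [Nat.sub_add_cancel (by omega)] at e3 e4
    have c1 := count_take_drop d.toList U (2 * s + c + 1) (c - 1 + (b - 1))
    have c2 := count_take_drop d.toList D (2 * s + c + 1) (c - 1 + (b - 1))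
    have hx : 2 * s + c + 1 + (c - 1 + (b - 1)) = 2 * (s + c) + b - 1 := by omega
    rw [hx] at c1 c2
    change ups _ _ + _ = ups _ _ at c1
    change downs _ _ + _ = downs _ _ at c2
    refine mem_tails_cons.mpr ⟨(d.toList.drop (2 * s + c + 1)).take (c - 1 + (b - 1)),
      _, ⟨by omega, by omega⟩, ht, ?_⟩
    rw [drop_eq_cons h2, List.cons_append, List.append_assoc, List.singleton_append,
      show 2 * (s + c) + b = 2 * (s + c) + b - 1 + 1 by omega, ← drop_eq_cons hU, ← hx,
      ← List.drop_drop (i := c - 1 + (b - 1)) (j := 2 * s + c + 1), List.take_append_drop]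

/-- Converse of the previous lemma: the D opening each block stops the bounce ascent there, and the
U closing it makes the next bounce peak a peak of `d`. -/
lemma isBounce_of_mem_tails {d : DyckWord} {s c : ℕ} {cs : List ℕ} {l t : List DyckStep}
    (hc : 0 < c) (hcs : ∀ c ∈ cs, 0 < c) (hd : d.toList = l ++ t) (hU : l.count U = s + c)
    (hD : l.count D = s) (ht : t ∈ tails c cs) :
    IsBounce d s (c :: cs) ∧ UpBefore d (s + c) cs := by
  induction cs generalizing s c l t with
  | nil =>
    rw [tails, Finset.mem_singleton] at ht
    subst ht
    have hlen := count_U_add_count_D l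
    refine ⟨⟨hc, ?_, ?_, ?_⟩, trivial⟩
    · have h1 := ups_append l (List.replicate c D) 0
      have h2 := downs_append l (List.replicate c D) 0
      rw [OnPath, show s + c + s = l.length + 0 by omega, hd, h1, h2, hU, hD, ups_zero, downs_zero]
      exact ⟨rfl, rfl⟩
    · rw [hd, show 2 * s + c = l.length by omega]
      rw [List.getElem?_append_right le_rfl, Nat.sub_self, List.getElem?_replicate, if_pos hc]
    · change s + c = d.semilength
      rw [DyckWord.semilength, hd, List.count_append, hU]
      simp [List.count_replicate]
  | cons b cs ih =>
    obtain ⟨w, t, ⟨h1, h2⟩, h3, rfl⟩ := mem_tails_cons.mp ht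
    rw [List.forall_mem_cons] at hcs
    have hlen := count_U_add_count_D l
    have hlen' := count_U_add_count_D w
    obtain ⟨i1, i2⟩ := ih (s := s + c) (l := l ++ (D :: (w ++ [U]))) (t := t) hcs.1 hcs.2
      (by rw [hd, List.append_assoc]) (by simp [hU, h2]; omega) (by simp [hD, h1]; omega) h3
    refine ⟨⟨hc, ?_, ?_, i1⟩, ?_, i2⟩
    · have h1 := ups_append l (D :: (w ++ [U]) ++ t) 0
      have h2 := downs_append l (D :: (w ++ [U]) ++ t) 0
      rw [OnPath, show s + c + s = l.length + 0 by omega, hd, h1, h2, hU, hD, ups_zero, downs_zero]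
      exact ⟨rfl, rfl⟩
    · rw [hd, show 2 * s + c = l.length by omega]
      simp
    · have hl : d.toList = (l ++ (D :: w)) ++ (U :: t) := by rw [hd]; simp
      rw [hl, show 2 * (s + c) + b - 1 = (l ++ (D :: w)).length by
        rw [List.length_append, List.length_cons]; have := hcs.1; omega]
      simp

/-- The path `U ^ a` followed by `t ∈ tails a cs`. -/
def ofTail {a : ℕ} {cs : List ℕ} (ha : 0 < a) (hcs : ∀ c ∈ cs, 0 < c) {t : List DyckStep}
    (ht : t ∈ tails a cs) : DyckWord where
  toList := List.replicate a U ++ t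
  count_U_eq_count_D := by
    obtain ⟨h1, h2, -⟩ := tails_properties ha hcs ht
    simp [List.count_replicate, h1, h2]
  count_D_le_count_U x := by
    change downs _ x ≤ ups _ x
    rcases le_or_gt x (List.replicate a U).length with hx | hx
    · rw [downs_append_of_le _ hx]
      simp [downs, List.take_replicate, List.count_replicate]
    · obtain ⟨y, rfl⟩ := Nat.exists_eq_add_of_le hx.le
      rw [downs_append, ups_append]
      simpa [List.count_replicate] using (tails_properties ha hcs ht).2.2 y

lemma toList_injective : Function.Injective DyckWord.toList := fun _ _ h => DyckWord.ext h

theorem ncard_peaks_bounce_subset {cs : List ℕ} (hcs : ∀ c ∈ cs, 0 < c) :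
    {d : DyckWord | bcomp d = cs ∧ peaks (bounce d) ⊆ peaks d}.ncard = listWeight cs := by
  simp only [peaks_bounce_subset_iff]
  cases cs with
  | nil =>
    rw [listWeight_nil, Set.ncard_eq_one]
    refine ⟨0, Set.eq_singleton_iff_unique_mem.mpr ⟨?_, ?_⟩⟩
    · have : bcomp 0 = [] := rfl
      exact ⟨this, this ▸ trivial⟩
    · rintro d ⟨hd, -⟩
      have := bcomp_sum d
      rw [hd, List.sum_nil] at this
      rw [← DyckWord.toList_eq_nil, ← List.length_eq_zero_iff, length_toList, ← this, mul_zero]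
  | cons a cs =>
    rw [List.forall_mem_cons] at hcs
    have key : DyckWord.toList '' {d : DyckWord | bcomp d = a :: cs ∧ UpBefore d 0 (bcomp d)} =
        (List.replicate a U ++ ·) '' (tails a cs : Set (List DyckStep)) := by
      ext l
      constructor
      · rintro ⟨d, ⟨h1, h2⟩, rfl⟩
        have hb := isBounce_bcomp d
        rw [h1] at h2 hb
        refine ⟨_, hb.drop_mem_tails h2.2, ?_⟩
        obtain ⟨-, hon, -, -⟩ := hb
        rw [OnPath, zero_add, add_zero] at hon
        have h3 := lt_length_of_getElem? h2.1
        have h4 : (d.toList.take a).length = a := by rw [List.length_take]; omega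
        have h5 := eq_replicate_of_count_D_eq_zero hon.2
        rw [h4] at h5
        simp only [mul_zero, zero_add]
        rw [← h5, List.take_append_drop]
      · rintro ⟨t, ht, rfl⟩
        obtain ⟨h1, h2⟩ := isBounce_of_mem_tails (d := ofTail hcs.1 hcs.2 ht) (s := 0)
          hcs.1 hcs.2 rfl (by simp) (by simp [List.count_replicate]) ht
        refine ⟨_, ⟨h1.eq_bcomp, ?_⟩, rfl⟩
        rw [h1.eq_bcomp]
        refine ⟨?_, h2⟩
        have ha := hcs.1
        exact (List.getElem?_append_left (by simpa using ha)).trans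
          (by rw [List.getElem?_replicate, if_pos (by omega)])
    rw [← Set.ncard_image_of_injective _ toList_injective, key,
      Set.ncard_image_of_injective _ (List.append_right_injective _), Set.ncard_coe_finset,
      card_tails hcs.1 hcs.2]

/-! ### Summation over compositions -/

lemma finite_semilength_eq (n : ℕ) : {d : DyckWord | d.semilength = n}.Finite :=
  Set.finite_coe_iff.mp (Finite.of_fintype {d : DyckWord // d.semilength = n})

/-- Splits the count along the fibres of a composition-valued statistic `g`; applied with `g =
bcomp` and with `g = levels`. -/
lemma ncard_eq_sum_weight {P : DyckWord → Prop} {g : DyckWord → List ℕ}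
    (hpos : ∀ d, ∀ c ∈ g d, 0 < c) (hsum : ∀ d, (g d).sum = d.semilength)
    (hcard : ∀ cs : List ℕ, (∀ c ∈ cs, 0 < c) → {d | g d = cs ∧ P d}.ncard = listWeight cs)
    (n : ℕ) : {d : DyckWord | d.semilength = n ∧ P d}.ncard = ∑ c : Composition n, weight c := by
  classical
  have hfin : {d : DyckWord | d.semilength = n ∧ P d}.Finite :=
    (finite_semilength_eq n).subset fun d hd => hd.1
  rw [Set.ncard_eq_toFinset_card _ hfin, Finset.card_eq_sum_card_fiberwise (f := g)
    (t := Finset.univ.image (Composition.blocks (n := n))), Finset.sum_image]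
  · refine Finset.sum_congr rfl fun c _ => ?_
    rw [weight_eq, ← hcard c.blocks (fun _ h => c.blocks_pos h), ← Set.ncard_coe_finset]
    congr 1
    ext d
    simp only [Finset.coe_filter, Set.Finite.mem_toFinset, Set.mem_ofPred_eq]
    constructor
    · rintro ⟨⟨-, h1⟩, h2⟩
      exact ⟨h2, h1⟩
    · rintro ⟨h2, h1⟩
      exact ⟨⟨by rw [← hsum, h2, c.blocks_sum], h1⟩, h2⟩
  · exact fun c _ c' _ h => Composition.ext h
  · intro d hd
    rw [Finset.mem_coe, Set.Finite.mem_toFinset] at hd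
    exact Finset.mem_coe.mpr (Finset.mem_image.mpr
      ⟨⟨g d, fun h => hpos d _ h, (hsum d).trans hd.1⟩, Finset.mem_univ _, rfl⟩)

/-! ### Decomposition into components, and levels -/

/-- The Dyck words `A₁, …, Aₘ` such that `d = A₁.nest + ⋯ + Aₘ.nest`. -/
def children (d : DyckWord) : List DyckWord :=
  if _h : d = 0 then [] else d.insidePart :: children d.outsidePart
termination_by d.semilength
decreasing_by exact DyckWord.semilength_outsidePart_lt ‹_›

/-- The Dyck word `A₁.nest + ⋯ + Aₘ.nest`. -/
def ofChildren (L : List DyckWord) : DyckWord := (L.map DyckWord.nest).sum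

lemma ofChildren_nil : ofChildren [] = 0 := rfl

lemma ofChildren_cons (A : DyckWord) (L : List DyckWord) :
    ofChildren (A :: L) = A.nest + ofChildren L := by
  simp [ofChildren]

lemma children_zero : children 0 = [] := by
  rw [children, dif_pos rfl]

lemma nest_add_ne_zero (A X : DyckWord) : A.nest + X ≠ 0 := fun h => by
  have := congrArg DyckWord.semilength h
  simp at this

lemma insidePart_nest_add (A X : DyckWord) : (A.nest + X).insidePart = A := by simp

lemma outsidePart_nest_add (A X : DyckWord) : (A.nest + X).outsidePart = X := by simp

lemma children_nest_add (A X : DyckWord) : children (A.nest + X) = A :: children X := by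
  rw [children, dif_neg (nest_add_ne_zero A X), insidePart_nest_add, outsidePart_nest_add]

lemma nest_add_inj {A A' X X' : DyckWord} (h : A.nest + X = A'.nest + X') : A = A' ∧ X = X' := by
  have h1 := congrArg DyckWord.insidePart h
  have h2 := congrArg DyckWord.outsidePart h
  rw [insidePart_nest_add, insidePart_nest_add] at h1
  rw [outsidePart_nest_add, outsidePart_nest_add] at h2
  exact ⟨h1, h2⟩

lemma exists_eq_nest_add {d : DyckWord} (h : d ≠ 0) : ∃ A X : DyckWord, d = A.nest + X :=
  ⟨_, _, (DyckWord.nest_insidePart_add_outsidePart h).symm⟩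

lemma children_ofChildren (L : List DyckWord) : children (ofChildren L) = L := by
  induction L with
  | nil => exact children_zero
  | cons A L ih => rw [ofChildren_cons, children_nest_add, ih]

lemma exists_ofChildren (d : DyckWord) : ∃ L, d = ofChildren L := by
  by_cases h : d = 0
  · exact ⟨[], h⟩
  · obtain ⟨L, hL⟩ := exists_ofChildren d.outsidePart
    refine ⟨d.insidePart :: L, ?_⟩
    rw [ofChildren_cons, ← hL, DyckWord.nest_insidePart_add_outsidePart h]
termination_by d.semilength
decreasing_by exact DyckWord.semilength_outsidePart_lt h

lemma ofChildren_children (d : DyckWord) : ofChildren (children d) = d := by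
  obtain ⟨L, rfl⟩ := exists_ofChildren d
  rw [children_ofChildren]

lemma children_injective : Function.Injective children :=
  Function.LeftInverse.injective ofChildren_children

lemma semilength_ofChildren (L : List DyckWord) :
    (ofChildren L).semilength = L.length + L.sum.semilength := by
  induction L with
  | nil => rfl
  | cons A L ih =>
    rw [ofChildren_cons, DyckWord.semilength_add, DyckWord.semilength_nest, ih, List.sum_cons,
      DyckWord.semilength_add, List.length_cons]
    ring

lemma semilength_eq_children (d : DyckWord) :
    d.semilength = (children d).length + (children d).sum.semilength := by
  conv_lhs => rw [← ofChildren_children d]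
  exact semilength_ofChildren _

lemma children_length_pos {d : DyckWord} (h : d ≠ 0) : 0 < (children d).length := by
  obtain ⟨A, X, rfl⟩ := exists_eq_nest_add h
  rw [children_nest_add]
  exact Nat.succ_pos _

lemma semilength_sum_children_lt {d : DyckWord} (h : d ≠ 0) :
    (children d).sum.semilength < d.semilength := by
  have := children_length_pos h
  rw [semilength_eq_children d]
  omega

/-- The numbers of up-steps ending at the heights `1, 2, …`. -/
def levels (d : DyckWord) : List ℕ :=
  if _h : d = 0 then [] else (children d).length :: levels (children d).sum
termination_by d.semilength
decreasing_by exact semilength_sum_children_lt ‹_›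

lemma levels_zero : levels 0 = [] := by rw [levels, dif_pos rfl]

lemma levels_of_ne {d : DyckWord} (h : d ≠ 0) :
    levels d = (children d).length :: levels (children d).sum := by rw [levels, dif_neg h]

lemma levels_eq_nil_iff {d : DyckWord} : levels d = [] ↔ d = 0 := by
  constructor
  · intro h
    by_contra hd
    rw [levels_of_ne hd] at h
    simp at h
  · rintro rfl
    exact levels_zero

lemma levels_pos (d : DyckWord) : ∀ c ∈ levels d, 0 < c := by
  by_cases h : d = 0
  · rw [h, levels_zero]; simp
  · rw [levels_of_ne h, List.forall_mem_cons]
    exact ⟨children_length_pos h, levels_pos _⟩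
termination_by d.semilength
decreasing_by exact semilength_sum_children_lt h

lemma levels_sum (d : DyckWord) : (levels d).sum = d.semilength := by
  by_cases h : d = 0
  · rw [h, levels_zero]; rfl
  · rw [levels_of_ne h, List.sum_cons, levels_sum, ← semilength_eq_children]
termination_by d.semilength
decreasing_by exact semilength_sum_children_lt h

/-! ### Height bounds and the first peak -/

/-- The path never goes above the height `k`. -/
def Bounded (d : DyckWord) (k : ℕ) : Prop := ∀ x, height d x ≤ k

/-- The height of the first peak. -/
def firstAscent (d : DyckWord) : ℕ := (d.toList.takeWhile (· = U)).length

lemma height_add_of_le (A B : DyckWord) {x : ℕ} (h : x ≤ A.toList.length) :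
    height (A + B) x = height A x := by
  have : (A + B).toList = A.toList ++ B.toList := rfl
  rw [height_eq, height_eq, this, ups_append_of_le _ h, downs_append_of_le _ h]

lemma height_add_add (A B : DyckWord) (x : ℕ) :
    height (A + B) (A.toList.length + x) = height B x := by
  have : (A + B).toList = A.toList ++ B.toList := rfl
  rw [height_eq, height_eq, this, ups_append, downs_append, A.count_U_eq_count_D]
  push_cast; ring

lemma bounded_add {A B : DyckWord} {k : ℕ} : Bounded (A + B) k ↔ Bounded A k ∧ Bounded B k := by
  constructor
  · refine fun h => ⟨fun x => ?_, fun x => ?_⟩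
    · rcases le_or_gt x A.toList.length with hx | hx
      · rw [← height_add_of_le A B hx]; exact h x
      · rw [height_of_length_le hx.le]; exact Int.natCast_nonneg k
    · rw [← height_add_add A B]; exact h _
  · rintro ⟨hA, hB⟩ x
    rcases le_or_gt x A.toList.length with hx | hx
    · rw [height_add_of_le A B hx]; exact hA x
    · obtain ⟨y, rfl⟩ := Nat.exists_eq_add_of_le hx.le
      rw [height_add_add]; exact hB y

lemma height_nest_succ (A : DyckWord) {x : ℕ} (h : x ≤ A.toList.length) :
    height A.nest (x + 1) = height A x + 1 := by
  have hl : A.nest.toList = [U] ++ (A.toList ++ [D]) := by simp [DyckWord.nest]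
  have h1 := ups_append [U] (A.toList ++ [D]) x
  have h2 := downs_append [U] (A.toList ++ [D]) x
  rw [ups_append_of_le _ h] at h1
  rw [downs_append_of_le _ h] at h2
  rw [height_eq, height_eq, hl, add_comm x 1]
  simp only [List.length_singleton] at h1 h2
  rw [h1, h2]
  simp; ring

lemma bounded_nest {A : DyckWord} {k : ℕ} : Bounded A.nest (k + 1) ↔ Bounded A k := by
  constructor
  · intro h x
    rcases le_or_gt x A.toList.length with hx | hx
    · have := h (x + 1)
      rw [height_nest_succ A hx] at this
      push_cast at this
      omega
    · rw [height_of_length_le hx.le]; exact Int.natCast_nonneg k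
  · intro h x
    rcases x with _ | x
    · have : height A.nest 0 = 0 := by simp [height]
      rw [this]; exact Int.natCast_nonneg _
    · rcases le_or_gt x A.toList.length with hx | hx
      · have := h x
        rw [height_nest_succ A hx]
        push_cast
        omega
      · rw [height_of_length_le (by simp [DyckWord.nest]; omega)]; exact Int.natCast_nonneg _

lemma bounded_zero (k : ℕ) : Bounded 0 k := fun x => by
  rw [height_of_length_le (Nat.zero_le _)]; exact Int.natCast_nonneg k

lemma bounded_ofChildren {L : List DyckWord} {k : ℕ} :
    Bounded (ofChildren L) (k + 1) ↔ Bounded L.sum k := by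
  induction L with
  | nil => exact iff_of_true (bounded_zero _) (bounded_zero _)
  | cons A L ih => rw [ofChildren_cons, bounded_add, bounded_nest, ih, List.sum_cons, bounded_add]

lemma takeWhile_append_D (l m : List DyckStep) :
    (l ++ D :: m).takeWhile (· = U) = l.takeWhile (· = U) := by
  induction l with
  | nil => simp
  | cons s l ih => rcases s.dichotomy with rfl | rfl <;> simp [ih]

lemma firstAscent_nest_add (A X : DyckWord) : firstAscent (A.nest + X) = firstAscent A + 1 := by
  have : (A.nest + X).toList = U :: (A.toList ++ D :: X.toList) := by
    change A.nest.toList ++ X.toList = _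
    simp [DyckWord.nest]
  rw [firstAscent, this, List.takeWhile_cons_of_pos (by simp), takeWhile_append_D,
    List.length_cons, firstAscent]

lemma firstAscent_add {A : DyckWord} (h : A ≠ 0) (B : DyckWord) :
    firstAscent (A + B) = firstAscent A := by
  obtain ⟨A, X, rfl⟩ := exists_eq_nest_add h
  rw [add_assoc, firstAscent_nest_add, firstAscent_nest_add]

lemma bounded_zero_iff {d : DyckWord} : Bounded d 0 ↔ d = 0 := by
  constructor
  · intro h
    by_contra hd
    obtain ⟨A, X, rfl⟩ := exists_eq_nest_add hd
    have := (bounded_add.mp h).1 (0 + 1)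
    rw [height_nest_succ A (Nat.zero_le _)] at this
    simp [height] at this
  · rintro rfl
    exact bounded_zero 0

/-- A nonempty path begins with `run p q`, so its leftmost peak is the point (p, p), with p the
first ascent. -/
lemma maxAtFirstPeak_iff (d : DyckWord) : MaxAtFirstPeak d ↔ Bounded d (firstAscent d) := by
  by_cases hd : d = 0
  · subst hd
    refine iff_of_true (fun P hP => ?_) (bounded_zero _)
    obtain ⟨i, hi, -⟩ := mem_peaks.mp hP
    simp [show (0 : DyckWord).toList = [] from rfl, peakIdx] at hi
  · have hne := DyckWord.toList_ne_nil.mpr hd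
    have hD : 0 < d.toList.count D := by
      have h1 := count_U_add_count_D d.toList
      have h2 := d.count_U_eq_count_D
      have := List.length_pos_iff.mpr hne
      omega
    obtain ⟨p, q, l, hp, hq, -, hl⟩ := exists_run hne (head?_toList_ne d) hD
    have hf : firstAscent d = p := by rw [firstAscent, hl, takeWhile_run hq, List.length_replicate]
    have hh : height d p = p := by
      rw [height_eq, hl, ups_run_of_le _ _ _ le_rfl, downs_run_of_le _ _ _ le_rfl]; simp
    have hmem : ∀ {i}, i ∈ peakIdx d.toList ↔ i + 1 = p ∨ ∃ j ∈ peakIdx l, i = p + q + j := by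
      rw [hl]; exact mem_peakIdx_run hp hq
    have hP : ((p, (p : ℤ)) : ℕ × ℤ) ∈ peaks d := by
      refine mem_peaks.mpr ⟨p - 1, hmem.mpr (Or.inl (by omega)), ?_⟩
      rw [Nat.sub_add_cancel hp, hh]
    have hmin : ∀ Q ∈ peaks d, p ≤ Q.1 := by
      intro Q hQ
      obtain ⟨i, hi, rfl⟩ := mem_peaks.mp hQ
      rcases hmem.mp hi with h | ⟨j, -, rfl⟩
      · exact h.ge
      · simp only; omega
    rw [hf]
    constructor
    · exact fun h => h _ hP hmin
    · intro h P hP' hPmin x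
      have h1 : P.1 = p := le_antisymm (hPmin _ hP) (hmin _ hP')
      obtain ⟨i, -, rfl⟩ := mem_peaks.mp hP'
      simp only at h1
      rw [h1, hh]
      exact h x

/-- Removing the lowest level decreases the maximum height by one. If the first child is empty, the
first peak has height 1, so all children must be empty. Otherwise the first ascent also decreases by
exactly one, because the concatenation of the children begins with the first child. -/
lemma maxAtFirstPeak_iff_children {d : DyckWord} (hd : d ≠ 0) :
    MaxAtFirstPeak d ↔ (children d).sum = 0 ∨
      ((children d).head? ≠ some 0 ∧ MaxAtFirstPeak (children d).sum) := by
  rcases hL : children d with _ | ⟨A, L⟩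
  · have := children_length_pos hd
    simp [hL] at this
  · obtain rfl : d = ofChildren (A :: L) := by rw [← hL, ofChildren_children]
    have hf : firstAscent (ofChildren (A :: L)) = firstAscent A + 1 := by
      rw [ofChildren_cons, firstAscent_nest_add]
    rw [maxAtFirstPeak_iff, hf, bounded_ofChildren, maxAtFirstPeak_iff]
    by_cases hA : A = 0
    · subst hA
      simp only [List.head?_cons, ne_eq, not_true_eq_false, false_and, or_false]
      exact bounded_zero_iff
    · rw [List.sum_cons, firstAscent_add hA]
      simp only [List.head?_cons, ne_eq, Option.some.injEq, hA, not_false_eq_true, true_and]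
      refine ⟨Or.inr, ?_⟩
      rintro (h | h)
      · rw [h]; exact bounded_zero _
      · exact h

/-! ### Cutting a path into a given number of words -/

/-- Put `A.nest` in front of the first word of a list. -/
def addHead (A : DyckWord) : List DyckWord → List DyckWord
  | [] => []
  | Y :: L => (A.nest + Y) :: L

lemma addHead_injective (A : DyckWord) : Function.Injective (addHead A) := by
  rintro (_ | ⟨Y, L⟩) (_ | ⟨Y', L'⟩) h
  · rfl
  · simp [addHead] at h
  · simp [addHead] at h
  · simpa [addHead] using h

/-- The lists of `a` Dyck words with sum `ofChildren X`. -/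
def splits : ℕ → List DyckWord → Finset (List DyckWord)
  | 0, [] => {[]}
  | 0, _ :: _ => ∅
  | a + 1, [] => {List.replicate (a + 1) 0}
  | a + 1, A :: X => (splits a (A :: X)).image (0 :: ·) ∪ (splits (a + 1) X).image (addHead A)

lemma sum_eq_zero_iff {L : List DyckWord} : L.sum = 0 ↔ L = List.replicate L.length 0 := by
  constructor
  · intro h
    induction L with
    | nil => rfl
    | cons A L ih =>
      have := congrArg DyckWord.semilength h
      rw [List.sum_cons, DyckWord.semilength_add, DyckWord.semilength_zero, Nat.add_eq_zero_iff]
        at this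
      have hA : A = 0 := by
        rw [← DyckWord.toList_eq_nil, ← List.length_eq_zero_iff, length_toList, this.1]
      rw [hA, List.sum_cons, zero_add] at h
      rw [List.length_cons, List.replicate_succ, ← ih h, hA]
  · intro h
    rw [h]; simp

/-- The recursion asks whether the first word is empty; if not, it begins with the first component
`A.nest`, which can be removed. -/
lemma mem_splits {a : ℕ} {X L : List DyckWord} :
    L ∈ splits a X ↔ L.length = a ∧ L.sum = ofChildren X := by
  induction a, X using splits.induct generalizing L with
  | case1 =>
    rw [splits, Finset.mem_singleton, List.length_eq_zero_iff]
    exact ⟨fun h => ⟨h, by rw [h]; rfl⟩, And.left⟩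
  | case2 A X =>
    rw [splits, List.length_eq_zero_iff]
    refine iff_of_false (Finset.notMem_empty _) ?_
    rintro ⟨rfl, h⟩
    rw [ofChildren_cons] at h
    exact nest_add_ne_zero _ _ h.symm
  | case3 a =>
    rw [splits, Finset.mem_singleton, ofChildren_nil, sum_eq_zero_iff]
    constructor
    · rintro rfl; simp
    · rintro ⟨h1, h2⟩; rw [h2, h1]
  | case4 a A X ih1 ih2 =>
    rw [splits, Finset.mem_union, Finset.mem_image, Finset.mem_image]
    constructor
    · rintro (⟨L, hL, rfl⟩ | ⟨L, hL, rfl⟩)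
      · rw [ih1] at hL
        simpa using hL
      · rw [ih2] at hL
        rcases L with _ | ⟨Y, L⟩
        · simp at hL
        · rw [ofChildren_cons, ← hL.2]
          exact ⟨hL.1, by simp [addHead, add_assoc]⟩
    · rintro ⟨h1, h2⟩
      rcases L with _ | ⟨Y, L⟩
      · simp at h1
      · by_cases hY : Y = 0
        · exact Or.inl ⟨L, ih1.mpr ⟨by simpa using h1, by simpa [hY] using h2⟩, by rw [hY]⟩
        · obtain ⟨A', Y, rfl⟩ := exists_eq_nest_add hY
          rw [List.sum_cons, add_assoc, ofChildren_cons] at h2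
          obtain ⟨rfl, h3⟩ := nest_add_inj h2
          exact Or.inr ⟨Y :: L, ih2.mpr ⟨h1, by rw [List.sum_cons, h3]⟩, rfl⟩

/-- Cuts fall between components, so the components are distributed in order among the words; the
recursion of `splits` is that of `Nat.multichoose`. -/
lemma card_splits (a : ℕ) (X : List DyckWord) :
    (splits a X).card = a.multichoose X.length := by
  induction a, X using splits.induct with
  | case1 => simp [splits]
  | case2 A X => simp [splits]
  | case3 a => simp [splits]
  | case4 a A X ih1 ih2 =>
    rw [splits, Finset.card_union_of_disjoint, Finset.card_image_of_injective _ List.cons_injective,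
      Finset.card_image_of_injective _ (addHead_injective A), ih1, ih2, List.length_cons,
      Nat.multichoose_succ_succ]
    rw [Finset.disjoint_left]
    intro L h1 h2
    rw [Finset.mem_image] at h1 h2
    obtain ⟨L₁, -, rfl⟩ := h1
    obtain ⟨L₂, -, h⟩ := h2
    rcases L₂ with _ | ⟨Y, L₂⟩
    · simp [addHead] at h
    · simp only [addHead, List.cons.injEq] at h
      exact nest_add_ne_zero _ _ h.1

/-- The lists of `a` Dyck words with sum `d ≠ 0` which do not begin with the empty word. -/
def headedSplits (a : ℕ) (d : DyckWord) : Finset (List DyckWord) :=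
  (splits a (children d.outsidePart)).image (addHead d.insidePart)

/-- The first component is forced into the first word, and the other b - 1 are distributed freely
among the a words. -/
lemma card_headedSplits {a b : ℕ} (ha : 0 < a) {d : DyckWord} (hd : d ≠ 0)
    (hb : (children d).length = b) :
    (headedSplits a d).card = (a + b - 2).choose (b - 1) := by
  obtain ⟨A, X, rfl⟩ := exists_eq_nest_add hd
  rw [children_nest_add, List.length_cons] at hb
  rw [headedSplits, Finset.card_image_of_injective _ (addHead_injective _), card_splits,
    Nat.multichoose_eq, outsidePart_nest_add]
  congr 1 <;> omega

lemma mem_headedSplits {a : ℕ} (ha : 0 < a) {d : DyckWord} (hd : d ≠ 0) {L : List DyckWord} :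
    L ∈ headedSplits a d ↔ L.length = a ∧ L.sum = d ∧ L.head? ≠ some 0 := by
  obtain ⟨A, X, rfl⟩ := exists_eq_nest_add hd
  rw [headedSplits, outsidePart_nest_add, insidePart_nest_add, Finset.mem_image]
  simp only [mem_splits, ofChildren_children]
  constructor
  · rintro ⟨_ | ⟨Y, L⟩, ⟨h1, h2⟩, rfl⟩
    · exact absurd h1 ha.ne
    · refine ⟨h1, ?_, ?_⟩
      · rw [← h2]; simp [addHead, add_assoc]
      · simp [addHead]
  · rintro ⟨h1, h2, h3⟩
    rcases L with _ | ⟨Y, L⟩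
    · exact absurd h1 ha.ne
    · obtain ⟨A', Y, rfl⟩ := exists_eq_nest_add (d := Y) (by simpa using h3)
      rw [List.sum_cons, add_assoc] at h2
      obtain ⟨rfl, h4⟩ := nest_add_inj h2
      exact ⟨Y :: L, ⟨h1, by rw [List.sum_cons, h4]⟩, rfl⟩

/-- Group the paths by the path e left after removing the lowest level: for each admissible e there
are `headedSplits a e` choices, whose number depends only on a and the first entry b of `levels e`.
-/
theorem ncard_maxAtFirstPeak_levels {cs : List ℕ} (hcs : ∀ c ∈ cs, 0 < c) :
    {d : DyckWord | levels d = cs ∧ MaxAtFirstPeak d}.ncard = listWeight cs := by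
  classical
  induction cs with
  | nil =>
    rw [listWeight_nil, Set.ncard_eq_one]
    refine ⟨0, Set.eq_singleton_iff_unique_mem.mpr ⟨⟨levels_zero, ?_⟩, ?_⟩⟩
    · rw [maxAtFirstPeak_iff]; exact bounded_zero _
    · rintro d ⟨hd, -⟩
      exact levels_eq_nil_iff.mp hd
  | cons a cs ih =>
    rw [List.forall_mem_cons] at hcs
    obtain ⟨ha, hcs⟩ := hcs
    have hlev : ∀ {d : DyckWord}, levels d = a :: cs ↔
        (children d).length = a ∧ levels (children d).sum = cs := by
      intro d
      by_cases hd : d = 0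
      · subst hd
        rw [levels_zero, children_zero]
        refine iff_of_false (by simp) ?_
        rintro ⟨h, -⟩
        exact ha.ne h
      · rw [levels_of_ne hd, List.cons.injEq]
    have hne : ∀ {d : DyckWord}, levels d = a :: cs → d ≠ 0 := by
      rintro d h rfl
      rw [levels_zero] at h
      simp at h
    cases cs with
    | nil =>
      rw [listWeight_singleton, Set.ncard_eq_one]
      refine ⟨ofChildren (List.replicate a 0), Set.eq_singleton_iff_unique_mem.mpr ⟨?_, ?_⟩⟩
      · have h : levels (ofChildren (List.replicate a 0)) = [a] := by
          rw [hlev, children_ofChildren]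
          exact ⟨by simp, by simp [levels_zero]⟩
        refine ⟨h, (maxAtFirstPeak_iff_children (hne h)).mpr (Or.inl ?_)⟩
        rw [children_ofChildren]; simp
      · rintro d ⟨h, -⟩
        rw [hlev, levels_eq_nil_iff, sum_eq_zero_iff] at h
        rw [← ofChildren_children d, h.2, h.1]
    | cons b cs =>
      have ih := ih hcs
      have hfin : {d : DyckWord | levels d = b :: cs ∧ MaxAtFirstPeak d}.Finite :=
        (finite_semilength_eq (b :: cs).sum).subset fun d hd => by
          rw [Set.mem_ofPred_eq, ← levels_sum, hd.1]
      have hne' : ∀ d ∈ hfin.toFinset, d ≠ 0 := by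
        rintro d hd rfl
        rw [Set.Finite.mem_toFinset, Set.mem_ofPred_eq, levels_zero] at hd
        simp at hd
      have key : children '' {d : DyckWord | levels d = a :: b :: cs ∧ MaxAtFirstPeak d} =
          (hfin.toFinset.biUnion (headedSplits a) : Set (List DyckWord)) := by
        ext L
        rw [Finset.mem_coe, Finset.mem_biUnion]
        constructor
        · rintro ⟨d, ⟨h1, h2⟩, rfl⟩
          rw [maxAtFirstPeak_iff_children (hne h1)] at h2
          rw [hlev] at h1
          have h0 : (children d).sum ≠ 0 := fun h => by
            rw [h, levels_zero] at h1
            simp at h1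
          have h2 := h2.resolve_left h0
          exact ⟨_, hfin.mem_toFinset.mpr ⟨h1.2, h2.2⟩, (mem_headedSplits ha h0).mpr
            ⟨h1.1, rfl, h2.1⟩⟩
        · rintro ⟨e, he, hL⟩
          obtain ⟨h1, rfl, h2⟩ := (mem_headedSplits ha (hne' e he)).mp hL
          have he' := hfin.mem_toFinset.mp he
          have h : levels (ofChildren L) = a :: b :: cs := by
            rw [hlev, children_ofChildren]
            exact ⟨h1, he'.1⟩
          refine ⟨ofChildren L, ⟨h, (maxAtFirstPeak_iff_children (hne h)).mpr ?_⟩,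
            children_ofChildren L⟩
          rw [children_ofChildren]
          exact Or.inr ⟨h2, he'.2⟩
      -- The union is disjoint because a list of children determines its sum e.
      rw [← Set.ncard_image_of_injective _ children_injective, key, Set.ncard_coe_finset,
        Finset.card_biUnion, Finset.sum_const_nat (m := (a + b - 2).choose (b - 1)),
        ← Set.ncard_eq_toFinset_card _ hfin, ih, listWeight_cons_cons, mul_comm]
      · intro d hd
        apply card_headedSplits ha (hne' d hd)
        have := (hfin.mem_toFinset.mp hd).1
        rw [levels_of_ne (hne' d hd), List.cons.injEq] at this
        exact this.1
      · intro d hd e he hde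
        rw [Function.onFun, Finset.disjoint_left]
        intro L h1 h2
        rw [mem_headedSplits ha (hne' d hd)] at h1
        rw [mem_headedSplits ha (hne' e he)] at h2
        exact hde (h1.2.1.symm.trans h2.2.1)

end DyckBounce

theorem proposition6p4 :
    (∀ d : DyckWord, (DyckBounce.B d).ncard = 1 ↔
      DyckBounce.peaks (DyckBounce.bounce d) ⊆ DyckBounce.peaks d) ∧
    (∀ (n : ℕ) (c : Composition n),
      {d : DyckWord | d.semilength = n ∧ DyckBounce.bcomp d = c.blocks ∧
        DyckBounce.peaks (DyckBounce.bounce d) ⊆ DyckBounce.peaks d}.ncard =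
          DyckBounce.weight c) ∧
    (∀ n : ℕ,
      {d : DyckWord | d.semilength = n ∧ (DyckBounce.B d).ncard = 1}.ncard =
        ∑ c : Composition n, DyckBounce.weight c) ∧
    (∀ n : ℕ,
      {d : DyckWord | d.semilength = n ∧ (DyckBounce.B d).ncard = 1}.ncard =
        {d : DyckWord | d.semilength = n ∧ DyckBounce.MaxAtFirstPeak d}.ncard) := by
  have h3 : ∀ n : ℕ, {d : DyckWord | d.semilength = n ∧ (DyckBounce.B d).ncard = 1}.ncard =
      ∑ c : Composition n, DyckBounce.weight c := by
    simp only [DyckBounce.ncard_B_eq_one_iff]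
    exact DyckBounce.ncard_eq_sum_weight (fun d => (DyckBounce.isBounce_bcomp d).pos)
      DyckBounce.bcomp_sum fun _ h => DyckBounce.ncard_peaks_bounce_subset h
  refine ⟨DyckBounce.ncard_B_eq_one_iff, fun n c => ?_, h3, fun n => (h3 n).trans ?_⟩
  · rw [DyckBounce.weight_eq,
      ← DyckBounce.ncard_peaks_bounce_subset (fun _ h => c.blocks_pos h)]
    congr 1
    ext d
    refine ⟨And.right, fun h => ⟨?_, h⟩⟩
    rw [← DyckBounce.bcomp_sum, h.1, c.blocks_sum]
  · exact (DyckBounce.ncard_eq_sum_weight DyckBounce.levels_pos DyckBounce.levels_sum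
      (fun _ h => DyckBounce.ncard_maxAtFirstPeak_levels h) n).symm
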